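/- **Setting.** Let $A_0,A_1\in sl_2(\mathbb C)$ have eigenvalues $\pm\theta_0/2$ and $\pm\theta_1/2$, let $A_0+A_1=-\frac{\theta_\infty}{2}\,\mathrm{diag}(1,-1)$ with $\theta_\infty\ne0$, and let $A_0$ not be diagonal. The *hypergeometric system* with $\theta$-triple $(\theta_0,\theta_1,\theta_\infty)$ is $$\frac{d\Psi}{dz}=\Big(\frac{A_0}{z}+\frac{A_1}{z-1}\Big)\Psi ,\qquad(1)$$ and it corresponds to the triple $(\lambda,\mu,\nu)=(\theta_\infty-1,\theta_0,\theta_1)$. Two triples are equivalent if one is obtained from the other by a permutation and a transformation $(\lambda,\mu,\nu)\mapsto(l\pm\lambda,\,m\pm\mu,\,n\pm\nu)$ (independent signs) with $l,m,n\in\mathbb Z$ and $l+m+n$ even. An *$RS$-transformation* $\Phi(w)=S(w)\,\Psi(R(w))$ consists of a non-constant rational function $R$ (the $R$-part) and a matrix $S=\sqrt g\,T$ (the $S$-part) with $\det S=1$, where $g$ is a rational function and $T$ is a $2\times2$ matrix of rational functions. It maps (1) to the two-point Fuchsian system $$\frac{d\Phi}{dw}=\frac{A}{w}\,\Phi ,\qquad(2)$$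 if $S'+S\,R'\Big(\frac{A_0}{R}+\frac{A_1}{R-1}\Big)=\frac Aw\,S$. A *Belyi function* is a non-constant rational function $\mathbb{CP}^1\to\mathbb{CP}^1$ unramified outside the preimages of $0,1,\infty$. **Proposition.** Suppose that the triple of the system (1) is equivalent to the triple $(\lambda,\mu,\nu)$ of one of the rows of the Schwarz list with $\lambda=\frac12$ other than row 9: - row 1: $(\frac12,\frac12,\frac pn)$, with integers $p\ge1$ and $n\ge2p$; - row 2: $(\frac12,\frac13,\frac13)$; row 4: $(\frac12,\frac13,\frac14)$; row 6: $(\frac12,\frac13,\frac15)$; row 14: $(\frac12,\frac25,\frac13)$. Let $(s_0,s_1,s_\infty)$ and $F$ be, respectively, - row 1: $(\frac12,\frac pn,\frac12)$ and $F=z_1^2$ with $z_1=\frac{w+1}{w-1}$; - row 2: $(\frac13,\frac12,\frac13)$ and $F=-\dfrac{64(w+1)^3}{w(w-8)^3}$ (truncated tetrahedron); - row 4: $(\frac14,\frac12,\frac13)$ and $F=-\dfrac{108(w+1)^4w}{(w^2-14w+1)^3}$ (truncated cube); - rows 6 and 14: $(\frac13,\frac12,\frac15)$ and $(\frac13,\frac12,\frac25)$,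 and $F=\dfrac{(w^4+228w^3+494w^2-228w+1)^3}{1728\,w\,(w^2-11w-1)^5}$ (truncated icosahedron). Then there is a permutation $\tau$ of $\{0,1,\infty\}$ such that, for each $i\in\{0,1,\infty\}$, one of the numbers $\theta_{\tau(i)}-s_i$, $\theta_{\tau(i)}+s_i$ is an integer. For every such $\tau$, let $\sigma$ be the fractional linear transformation with $\sigma(i)=\tau(i)$ for $i=0,1,\infty$ (so $\sigma=\mathrm{id}$ if the $\theta$-triple is ordered as $(s_0,s_1,s_\infty)$). Then $R=\sigma\circ F$ is a Belyi function, and there is an $RS$-transformation with $R$-part $R$ which maps the system (1) to a system (2) whose matrix $A\in sl_2(\mathbb C)$ has non-zero rational eigenvalues $\pm r$. -/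

import Mathlib

open Polynomial

namespace RSTransformation

/-! ### Triples of exponent differences and the rows of the Schwarz list -/

/-- The equivalence of triples: `s` is turned into `t` by a permutation and a transformation
`sᵢ ↦ lᵢ ± sᵢ` (independent signs) with integers `lᵢ` whose sum is even. -/
def SchwarzEquiv (s t : Fin 3 → ℂ) : Prop :=
  ∃ (τ : Equiv.Perm (Fin 3)) (l : Fin 3 → ℤ) (ε : Fin 3 → ℤˣ),
    Even (∑ i, l i) ∧ ∀ i, t (τ i) = (l i : ℂ) + ((ε i : ℤ) : ℂ) * s i

/-- The rows of the Schwarz list with `λ = 1/2`, other than row 9. In row 1 there are two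
integer parameters, `p ≥ 1` and `n` with `2 p ≤ n`. -/
inductive SchwarzHalfRow : Type
  | row1 (p n : ℕ) (hp : 0 < p) (hpn : 2 * p ≤ n) : SchwarzHalfRow
  | row2 : SchwarzHalfRow
  | row4 : SchwarzHalfRow
  | row6 : SchwarzHalfRow
  | row14 : SchwarzHalfRow

/-- The triple `(λ, μ, ν)` that the Schwarz list gives in a row. -/
noncomputable def SchwarzHalfRow.triple : SchwarzHalfRow → (Fin 3 → ℂ)
  | .row1 p n _ _ => ![1 / 2, 1 / 2, (p : ℂ) / (n : ℂ)]
  | .row2 => ![1 / 2, 1 / 3, 1 / 3]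
  | .row4 => ![1 / 2, 1 / 3, 1 / 4]
  | .row6 => ![1 / 2, 1 / 3, 1 / 5]
  | .row14 => ![1 / 2, 2 / 5, 1 / 3]

/-- The first line of the `RS`-symbol: the same three numbers, distributed over the points
`0`, `1`, `∞` (in this order) to which the Belyi function `SchwarzHalfRow.belyi` is adapted. -/
noncomputable def SchwarzHalfRow.symbol : SchwarzHalfRow → (Fin 3 → ℂ)
  | .row1 p n _ _ => ![1 / 2, (p : ℂ) / (n : ℂ), 1 / 2]
  | .row2 => ![1 / 3, 1 / 2, 1 / 3]
  | .row4 => ![1 / 4, 1 / 2, 1 / 3]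
  | .row6 => ![1 / 3, 1 / 2, 1 / 5]
  | .row14 => ![1 / 3, 1 / 2, 2 / 5]

/-- The permutation `τ` of the points `0`, `1`, `∞` (numbered `0`, `1`, `2`) carries the numbers
of the symbol to the `θ`-triple, up to signs and integers. -/
def Matches (τ : Equiv.Perm (Fin 3)) (θ symbol : Fin 3 → ℂ) : Prop :=
  ∀ i, ∃ (l : ℤ) (ε : ℤˣ), θ (τ i) = (l : ℂ) + ((ε : ℤ) : ℂ) * symbol i

/-! ### Rational functions and Belyi functions -/

/-- The derivative of a rational function. -/
noncomputable def ratDeriv (f : RatFunc ℂ) : RatFunc ℂ :=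
  algebraMap ℂ[X] (RatFunc ℂ) (derivative f.num * f.denom - f.num * derivative f.denom) /
    algebraMap ℂ[X] (RatFunc ℂ) f.denom ^ 2

/-- `R = P / Q` in lowest terms, seen as a map of the Riemann sphere to itself, is a Belyi
function: it is not constant, and every point of the sphere (finite, or `∞`) over a value
`c ≠ 0, 1, ∞` has multiplicity at most one. The degree of `R` is `d = max (deg P) (deg Q)`; the
multiplicity over `c` of a finite point is its multiplicity as a root of `P - c Q`, and that of
the point `∞` is `d - deg (P - c Q)`. -/
def IsBelyi (R : RatFunc ℂ) : Prop :=
  ∃ P Q : ℂ[X], IsCoprime P Q ∧ Q ≠ 0 ∧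
    R = algebraMap ℂ[X] (RatFunc ℂ) P / algebraMap ℂ[X] (RatFunc ℂ) Q ∧
    0 < max P.natDegree Q.natDegree ∧
    ∀ c : ℂ, c ≠ 0 → c ≠ 1 →
      (∀ x : ℂ, (P - C c * Q).rootMultiplicity x ≤ 1) ∧
      max P.natDegree Q.natDegree ≤ (P - C c * Q).natDegree + 1

/-- The Belyi function of a row, with `X` the independent variable: for row 1 the function
`z₁²` with `z₁ = (X + 1) / (X - 1)`, and then the Belyi functions of the truncated tetrahedron,
of the truncated cube and of the truncated icosahedron. The coordinate is such that the two
points left singular by the transformation are `0` and `∞`. -/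
noncomputable def SchwarzHalfRow.belyi : SchwarzHalfRow → RatFunc ℂ
  | .row1 _ _ _ _ => ((RatFunc.X + 1) / (RatFunc.X - 1)) ^ 2
  | .row2 => -(64 * (RatFunc.X + 1) ^ 3) / (RatFunc.X * (RatFunc.X - 8) ^ 3)
  | .row4 => -(108 * (RatFunc.X + 1) ^ 4 * RatFunc.X) / (RatFunc.X ^ 2 - 14 * RatFunc.X + 1) ^ 3
  | .row6 | .row14 =>
      (RatFunc.X ^ 4 + 228 * RatFunc.X ^ 3 + 494 * RatFunc.X ^ 2 - 228 * RatFunc.X + 1) ^ 3 /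
        (1728 * RatFunc.X * (RatFunc.X ^ 2 - 11 * RatFunc.X - 1) ^ 5)

/-- The rational function `σ ∘ f`, where `σ` is the fractional linear transformation that
permutes the points `0`, `1`, `∞` (numbered `0`, `1`, `2`) as `τ` does. -/
noncomputable def anharmonic (τ : Equiv.Perm (Fin 3)) (f : RatFunc ℂ) : RatFunc ℂ :=
  match τ 0, τ 1 with
  | 0, 1 => f
  | 1, 0 => 1 - f
  | 2, 1 => 1 / f
  | 0, 2 => f / (f - 1)
  | 1, 2 => 1 / (1 - f)
  | 2, 0 => (f - 1) / f
  | _, _ => f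

/-! ### The two systems and `RS`-transformations -/

/-- The polynomial with roots `± r`. -/
noncomputable def pmPoly (r : ℂ) : ℂ[X] := (X - C r) * (X + C r)

/-- The data of the hypergeometric system `dΨ/dz = (A₀/z + A₁/(z-1)) Ψ` in its standard
normalization: `A₀`, `A₁` are traceless with eigenvalues `± θ₀/2`, `± θ₁/2`,
`A₀ + A₁ = -(θ∞/2) diag(1, -1)`, `θ∞ ≠ 0`, and `A₀` is not diagonal. -/
structure IsHypergeometric (A₀ A₁ : Matrix (Fin 2) (Fin 2) ℂ) (θ₀ θ₁ θinf : ℂ) : Prop where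
  trace_zero : A₀.trace = 0
  trace_one : A₁.trace = 0
  charpoly_zero : A₀.charpoly = pmPoly (θ₀ / 2)
  charpoly_one : A₁.charpoly = pmPoly (θ₁ / 2)
  sum_eq : A₀ + A₁ = (-(θinf / 2)) • !![1, 0; 0, -1]
  theta_inf_ne : θinf ≠ 0
  not_diag : ¬ A₀.IsDiag

/-- The data of the Fuchsian system `dΦ/dz = (A/z) Φ` with exactly the two singular points `0`
and `∞`: `A` is traceless with rational eigenvalues `± r`, and `r ≠ 0`. -/
def IsTwoPointFuchsian (A : Matrix (Fin 2) (Fin 2) ℂ) : Prop :=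
  A.trace = 0 ∧ ∃ r : ℚ, r ≠ 0 ∧ A.charpoly = pmPoly (r : ℂ)

/-- A constant matrix, as a matrix of rational functions. -/
noncomputable def constMatrix (A : Matrix (Fin 2) (Fin 2) ℂ) : Matrix (Fin 2) (Fin 2) (RatFunc ℂ) :=
  A.map (RatFunc.C : ℂ →+* RatFunc ℂ)

/-- The coefficient matrix of the pull-back of the hypergeometric system under `z = R(z₁)`:
`R' (A₀ / R + A₁ / (R - 1))`. -/
noncomputable def pullback (R : RatFunc ℂ) (A₀ A₁ : Matrix (Fin 2) (Fin 2) ℂ) :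
    Matrix (Fin 2) (Fin 2) (RatFunc ℂ) :=
  ratDeriv R • (R⁻¹ • constMatrix A₀ + (R - 1)⁻¹ • constMatrix A₁)

/-- The transformation `Φ(z₁) = S(z₁) Ψ(R(z₁))` maps the hypergeometric system with coefficients
`A₀`, `A₁` to the system `dΦ/dz₁ = (A/z₁) Φ`. Its `R`-part is the rational function `R`; its
`S`-part is `S = √g T`, where `T` is a matrix of rational functions, `g` is a rational function,
and `det S = g det T = 1` (Schlesinger transformations of traceless systems have square
roots of rational functions as scalar factors). The last condition is the equation
`S' + S P = (A/z₁) S`, where `P` is the coefficient matrix of the pulled back system, divided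
by `√g`. -/
structure IsRSTransformation (R g : RatFunc ℂ) (T : Matrix (Fin 2) (Fin 2) (RatFunc ℂ))
    (A₀ A₁ A : Matrix (Fin 2) (Fin 2) ℂ) : Prop where
  nonconstant : ∀ c : ℂ, R ≠ (RatFunc.C c : RatFunc ℂ)
  det_eq : g * T.det = 1
  gauge : (ratDeriv g / (2 * g)) • T + T.map ratDeriv + T * pullback R A₀ A₁ =
    ((RatFunc.X : RatFunc ℂ)⁻¹ • constMatrix A) * T

end RSTransformation

/-! This is Klein's pull-back principle made explicit. At every point over `0`, `1`, `∞` other than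
`w = 0` and `w = ∞`, the ramification index of `F` times the exponent difference `s_i` is an
integer. The pulled back scalar equation then has only apparent singularities away from `0` and `∞`,
and its solutions are elementary: the quotient of two of them is `w^(2r)`, in row 14 times `(w +
7)/(1 - 7w)`. The inverse of a fundamental matrix, stripped of the powers `w^(±r)` and scaled to
determinant one, is the matrix `S` (`isGauge_of_solutions`).

One explicit computation per row (`reduces_dihedral` to `reduces_icosahedral_great`) suffices, for
three reasons. An irreducible system is determined up to constant conjugation by its exponent
differences (`IsResiduePair.exists_conj`). Schlesinger transformations realize all integer shifts
with even sum, and an exponent difference `1/2 = 1 - 1/2` supplies the missing parity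
(`IsIrreducibleTriple.reducesAll_of_shifts`). A permutation of `0`, `1`, `∞` amounts to a Möbius
transformation of `R` (`reducesAll_anharmonic`). -/

namespace RSTransformation

/-! ### Gauge transformations over a differential field -/

section Gauge

variable {K : Type*} [Field K] [Algebra ℂ K] (D : Derivation ℂ K K)

/-- The matrix `√g T`, of determinant one, transforms the system `Ψ' = P Ψ` into `Φ' = P' Φ`. -/
def IsGauge (g : K) (T P P' : Matrix (Fin 2) (Fin 2) K) : Prop :=
  g * T.det = 1 ∧ (D g / (2 * g)) • T + T.map D + T * P = P' * T

variable {D}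

theorem map_derivation_mul (S T : Matrix (Fin 2) (Fin 2) K) :
    (S * T).map D = S.map D * T + S * T.map D := by
  ext i j
  simp only [Matrix.map_apply, Matrix.mul_apply, Fin.sum_univ_two, Matrix.add_apply, map_add,
    Derivation.leibniz, smul_eq_mul]
  ring

theorem IsGauge.trans {g₁ g₂ : K} {T₁ T₂ P P₁ P₂ : Matrix (Fin 2) (Fin 2) K}
    (h₁ : IsGauge D g₁ T₁ P P₁) (h₂ : IsGauge D g₂ T₂ P₁ P₂) :
    IsGauge D (g₁ * g₂) (T₂ * T₁) P P₂ := by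
  obtain ⟨d₁, e₁⟩ := h₁
  obtain ⟨d₂, e₂⟩ := h₂
  have hg₁ : g₁ ≠ 0 := left_ne_zero_of_mul_eq_one d₁
  have hg₂ : g₂ ≠ 0 := left_ne_zero_of_mul_eq_one d₂
  refine ⟨by rw [Matrix.det_mul]; linear_combination (g₂ * T₂.det) * d₁ + d₂, ?_⟩
  have hlog : D (g₁ * g₂) / (2 * (g₁ * g₂)) = D g₁ / (2 * g₁) + D g₂ / (2 * g₂) := by
    rw [Derivation.leibniz, smul_eq_mul, smul_eq_mul, add_comm, add_div, mul_comm g₁ (D g₂),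
      mul_comm g₂, ← mul_assoc, mul_div_mul_right _ _ hg₂, mul_right_comm,
      mul_div_mul_right _ _ hg₁]
  rw [hlog, map_derivation_mul, Matrix.mul_assoc, add_smul]
  have e₁' := congrArg (T₂ * ·) e₁
  have e₂' := congrArg (· * T₁) e₂
  simp only [Matrix.mul_add, Matrix.add_mul, Matrix.mul_smul, Matrix.smul_mul,
    Matrix.mul_assoc] at e₁' e₂' ⊢
  rw [← e₂', ← e₁']
  abel

theorem isGauge_of_conj {g : K} {U P P' : Matrix (Fin 2) (Fin 2) K} (hg : D g = 0)
    (hU : U.map D = 0) (hdet : g * U.det = 1) (h : U * P = P' * U) : IsGauge D g U P P' :=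
  ⟨hdet, by simp [hg, hU, h]⟩

/-- Two solutions `(x₁, q₁)`, `(x₂, q₂)` of the system `Ψ' = P Ψ`, up to the scalar factors with
logarithmic derivatives `∓ ρ + γ`, diagonalize the traceless system. -/
theorem isGauge_of_solutions {P : Matrix (Fin 2) (Fin 2) K} {γ ρ x₁ x₂ q₁ q₂ : K}
    (h2 : (2 : K) ≠ 0) (htr : P 0 0 + P 1 1 = 0)
    (hx₁ : D x₁ = (P 0 0 + γ - ρ) * x₁ + P 0 1 * q₁)
    (hq₁ : D q₁ = P 1 0 * x₁ + (P 1 1 + γ - ρ) * q₁)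
    (hx₂ : D x₂ = (P 0 0 + γ + ρ) * x₂ + P 0 1 * q₂)
    (hq₂ : D q₂ = P 1 0 * x₂ + (P 1 1 + γ + ρ) * q₂) (hw : x₁ * q₂ - x₂ * q₁ ≠ 0) :
    IsGauge D (x₁ * q₂ - x₂ * q₁)
      ((x₁ * q₂ - x₂ * q₁)⁻¹ • !![q₂, -x₂; -q₁, x₁]) P !![ρ, 0; 0, -ρ] := by
  set W := x₁ * q₂ - x₂ * q₁ with hW
  -- Liouville's formula: the trace of `P` vanishes, and the scalar factors contribute `γ - ρ` and
  -- `γ + ρ`. Hence `γ` is half the logarithmic derivative of `W`.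
  have hD : D W = 2 * γ * W := by
    rw [hW, map_sub, Derivation.leibniz, Derivation.leibniz]
    simp only [smul_eq_mul, hx₁, hq₁, hx₂, hq₂]
    linear_combination (x₁ * q₂ - x₂ * q₁) * htr
  have hlog : D W / (2 * W) = γ := by
    rw [hD]; field_simp
  have hinv : D W⁻¹ = - (2 * γ) * W⁻¹ := by
    rw [Derivation.leibniz_inv, hD, smul_eq_mul]; field_simp
  have hent : ∀ m, D (W⁻¹ * m) = W⁻¹ * (D m - 2 * γ * m) := by
    intro m
    rw [Derivation.leibniz, hinv, smul_eq_mul, smul_eq_mul]; ring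
  refine ⟨?_, ?_⟩
  · rw [Matrix.det_smul, Matrix.det_fin_two_of, Fintype.card_fin,
      show q₂ * x₁ - -x₂ * -q₁ = W by rw [hW]; ring]
    field_simp
  · rw [hlog]
    ext i j
    fin_cases i <;> fin_cases j <;>
      simp only [Fin.zero_eta, Fin.mk_one, Matrix.add_apply, Matrix.smul_apply, Matrix.map_apply,
        Matrix.mul_apply, Fin.sum_univ_two, Matrix.of_apply, Matrix.cons_val', Matrix.cons_val_zero,
        Matrix.cons_val_one, Matrix.cons_val_fin_one, smul_eq_mul, hent, map_neg, hx₁, hx₂, hq₁, hq₂]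
    · linear_combination W⁻¹ * q₂ * htr
    · linear_combination - W⁻¹ * x₂ * htr
    · linear_combination - W⁻¹ * q₁ * htr
    · linear_combination W⁻¹ * x₁ * htr

end Gauge

/-! ### Pairs of traceless matrices -/

/-- `A₀`, `A₁` and `-(A₀ + A₁)` are the residues of a Fuchsian system with singular points
`0`, `1`, `∞` and exponent differences `θ`. -/
structure IsResiduePair (θ : Fin 3 → ℂ) (A₀ A₁ : Matrix (Fin 2) (Fin 2) ℂ) : Prop where
  trace_zero : A₀.trace = 0
  trace_one : A₁.trace = 0
  det_zero : A₀.det = -(θ 0 / 2) ^ 2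
  det_one : A₁.det = -(θ 1 / 2) ^ 2
  det_inf : (A₀ + A₁).det = -(θ 2 / 2) ^ 2

/-- The residue at `0` of the normal form of an irreducible system. -/
noncomputable def normalZero (θ : Fin 3 → ℂ) : Matrix (Fin 2) (Fin 2) ℂ :=
  !![θ 0 / 2, 1; 0, -(θ 0 / 2)]

/-- The residue at `1` of the normal form of an irreducible system. -/
noncomputable def normalOne (θ : Fin 3 → ℂ) : Matrix (Fin 2) (Fin 2) ℂ :=
  !![-((θ 0 + θ 2) / 2), -1; ((θ 0 + θ 2) / 2) ^ 2 - (θ 1 / 2) ^ 2, (θ 0 + θ 2) / 2]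

/-- The exponent differences of an irreducible system, with all their integer shifts. -/
def IsIrreducibleTriple (θ : Fin 3 → ℂ) : Prop :=
  ∀ (ε δ : ℤˣ) (n : ℤ), θ 0 + ((ε : ℤ) : ℂ) * θ 1 + ((δ : ℤ) : ℂ) * θ 2 ≠ n

/-- Rigidity. Take a left eigenvector `w` of `A₀ + A₁`; the rows `w` and `w (A₀ - θ₀/2)` give the
normal form. They are dependent only if `w` is a common left eigenvector of `A₀` and `A₁`, and then
some combination `± θ₀ ± θ₁ ± θ₂` vanishes. -/
theorem IsResiduePair.exists_conj {θ : Fin 3 → ℂ} {A₀ A₁ : Matrix (Fin 2) (Fin 2) ℂ}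
    (h : IsResiduePair θ A₀ A₁) (hθ : IsIrreducibleTriple θ) :
    ∃ U : Matrix (Fin 2) (Fin 2) ℂ, U.det ≠ 0 ∧ U * A₀ = normalZero θ * U ∧
      U * A₁ = normalOne θ * U := by
  obtain ⟨t₀, t₁, d₀, d₁, d₂⟩ := h
  have hne : ∀ ε δ : ℤˣ, θ 0 + ((ε : ℤ) : ℂ) * θ 1 + ((δ : ℤ) : ℂ) * θ 2 ≠ 0 := by
    intro ε δ
    simpa using hθ ε δ 0
  have hpp : θ 0 + θ 1 + θ 2 ≠ 0 := by simpa using hne 1 1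
  have hpm : θ 0 + θ 1 - θ 2 ≠ 0 := by simpa [sub_eq_add_neg] using hne 1 (-1)
  have hmp : θ 0 - θ 1 + θ 2 ≠ 0 := by simpa [sub_eq_add_neg] using hne (-1) 1
  have hmm : θ 0 - θ 1 - θ 2 ≠ 0 := by simpa [sub_eq_add_neg] using hne (-1) (-1)
  obtain ⟨a, b, c, d, rfl⟩ : ∃ a b c d, A₀ = !![a, b; c, d] := ⟨_, _, _, _, Matrix.eta_fin_two A₀⟩
  obtain ⟨p, q, r, s, rfl⟩ : ∃ a b c d, A₁ = !![a, b; c, d] := ⟨_, _, _, _, Matrix.eta_fin_two A₁⟩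
  simp only [Matrix.trace_fin_two_of] at t₀ t₁
  obtain rfl : d = -a := by linear_combination t₀
  obtain rfl : s = -p := by linear_combination t₁
  simp [Matrix.det_fin_two] at d₀ d₁ d₂
  set α := θ 0 / 2 with hα
  set τ := θ 1 / 2 with hτ
  set κ := θ 2 / 2 with hκ
  -- A left eigenvector of `A₀ + A₁` with eigenvalue `-κ`.
  obtain ⟨w, hw, hwB⟩ : ∃ w : Fin 2 → ℂ, w ≠ 0 ∧
      Matrix.vecMul w !![a + p + κ, b + q; c + r, -a + -p + κ] = 0 := by
    rw [Matrix.exists_vecMul_eq_zero_iff, Matrix.det_fin_two_of]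
    linear_combination d₂
  obtain ⟨u, v, rfl⟩ : ∃ u v, w = ![u, v] := ⟨w 0, w 1, (List.ofFn_inj.1 rfl)⟩
  have e₁ : u * (a + p + κ) + v * (c + r) = 0 := by
    simpa [Matrix.vecMul, dotProduct] using congrFun hwB 0
  have e₂ : u * (b + q) + v * (-a + -p + κ) = 0 := by
    simpa [Matrix.vecMul, dotProduct] using congrFun hwB 1
  have huv : u = 0 → v ≠ 0 := by
    rintro rfl rfl
    exact hw (by ext i; fin_cases i <;> rfl)
  refine ⟨!![u, v; u * (a - α) + v * c, u * b - v * (a + α)], ?_, ?_, ?_⟩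
  · rw [Matrix.det_fin_two_of]
    intro hdet
    -- Dependent rows make `w` an eigenvector of `A₀`, with eigenvalue `l = ±α`; its eigenvalue for
    -- `A₁` is then `-(κ + l) = ±τ`.
    obtain ⟨l, l₁, l₂⟩ : ∃ l : ℂ, u * a + v * c = l * u ∧ u * b - v * a = l * v := by
      by_cases hu : u = 0
      · have hv := huv hu
        subst hu
        refine ⟨-a, ?_, by ring⟩
        have : v * (v * c) = 0 := by linear_combination -hdet
        simpa [hv] using this
      · refine ⟨(u * a + v * c) / u, by field_simp, ?_⟩
        field_simp
        linear_combination hdet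
    have hl : l ^ 2 = α ^ 2 := by
      by_cases hu : u = 0
      · have hv := huv hu
        subst hu
        apply mul_right_cancel₀ hv
        linear_combination (-l) * l₂ - b * l₁ + a * l₂ - v * d₀
      · apply mul_right_cancel₀ hu
        linear_combination (-l) * l₁ - a * l₁ - c * l₂ - u * d₀
    have hl' : (κ + l) ^ 2 = τ ^ 2 := by
      have m₁ : u * p + v * r = -(κ + l) * u := by linear_combination e₁ - l₁
      have m₂ : u * q - v * p = -(κ + l) * v := by linear_combination e₂ - l₂
      by_cases hu : u = 0
      · have hv := huv hu
        subst hu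
        apply mul_right_cancel₀ hv
        linear_combination (κ + l) * m₂ - q * m₁ + p * m₂ - v * d₁
      · apply mul_right_cancel₀ hu
        linear_combination (κ + l) * m₁ - p * m₁ - r * m₂ - u * d₁
    have h1 : (l - α) * (l + α) = 0 := by linear_combination hl
    have h2 : (κ + l - τ) * (κ + l + τ) = 0 := by linear_combination hl'
    rcases mul_eq_zero.1 h1 with h1 | h1 <;> rcases mul_eq_zero.1 h2 with h2 | h2
    · exact hmp (by linear_combination 2 * h2 - 2 * h1)
    · exact hpp (by linear_combination 2 * h2 - 2 * h1)
    · exact hpm (by linear_combination 2 * h1 - 2 * h2)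
    · exact hmm (by linear_combination 2 * h1 - 2 * h2)
  · ext i j
    fin_cases i <;> fin_cases j <;> simp [normalZero, Matrix.mul_apply, Fin.sum_univ_two, ← hα]
    · ring
    · ring
    · linear_combination -u * d₀
    · linear_combination -v * d₀
  · ext i j
    fin_cases i <;> fin_cases j <;>
      simp [normalOne, Matrix.mul_apply, Fin.sum_univ_two, add_div, ← hα, ← hτ, ← hκ]
    · linear_combination e₁
    · linear_combination e₂
    · linear_combination (p - α - κ) * e₁ + r * e₂ + u * d₁
    · linear_combination q * e₁ - (p + α + κ) * e₂ + v * d₁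

/-! ### Reduction of the pulled back systems -/

section Reduction

variable {K : Type*} [Field K] [Algebra ℂ K] (D : Derivation ℂ K K)

/-- The coefficient matrix of the pull-back of a Fuchsian system with residues `A₀`, `A₁` at
`0`, `1` under `z = R`. -/
def pulledMatrix (R : K) (A₀ A₁ : Matrix (Fin 2) (Fin 2) ℂ) : Matrix (Fin 2) (Fin 2) K :=
  (D R / R) • A₀.map (algebraMap ℂ K) + (D R / (R - 1)) • A₁.map (algebraMap ℂ K)

/-- The pull-back under `R` can be transformed to a two-point Fuchsian system in `x`. -/
def Reduces (x R : K) (A₀ A₁ : Matrix (Fin 2) (Fin 2) ℂ) : Prop :=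
  ∃ (A : Matrix (Fin 2) (Fin 2) ℂ) (g : K) (T : Matrix (Fin 2) (Fin 2) K),
    IsTwoPointFuchsian A ∧
      IsGauge D g T (pulledMatrix D R A₀ A₁) (x⁻¹ • A.map (algebraMap ℂ K))

/-- All pull-backs under `R` of systems with exponent differences `θ` can be transformed to
two-point Fuchsian systems in `x`. -/
def ReducesAll (x R : K) (θ : Fin 3 → ℂ) : Prop :=
  ∀ A₀ A₁, IsResiduePair θ A₀ A₁ → Reduces D x R A₀ A₁

variable {D} {x R : K} {θ θ' : Fin 3 → ℂ}

theorem IsResiduePair.congr_sq {A₀ A₁ : Matrix (Fin 2) (Fin 2) ℂ} (h : IsResiduePair θ A₀ A₁)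
    (hθ : ∀ i, θ i ^ 2 = θ' i ^ 2) : IsResiduePair θ' A₀ A₁ :=
  ⟨h.1, h.2, by rw [h.3, div_pow, div_pow, hθ], by rw [h.4, div_pow, div_pow, hθ],
    by rw [h.5, div_pow, div_pow, hθ]⟩

/-- Only the determinants of the residues see `θ`, so signs of exponent differences can be changed
freely. -/
theorem ReducesAll.congr_sq (h : ReducesAll D x R θ) (hθ : ∀ i, θ i ^ 2 = θ' i ^ 2) :
    ReducesAll D x R θ' :=
  fun _ _ hA => h _ _ (hA.congr_sq fun i => (hθ i).symm)

theorem reducesAll_one_sub (h : ReducesAll D x R ![θ 1, θ 0, θ 2]) :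
    ReducesAll D x (1 - R) θ := by
  intro A₀ A₁ hA
  have := h A₁ A₀ ⟨hA.2, hA.1, hA.4, hA.3, by rw [add_comm]; exact hA.5⟩
  rwa [Reduces, show pulledMatrix D R A₁ A₀ = pulledMatrix D (1 - R) A₀ A₁ by
    rw [pulledMatrix, pulledMatrix, add_comm, map_sub, D.map_one_eq_zero, zero_sub,
      show 1 - R - 1 = -R by ring, neg_div_neg_eq, show 1 - R = -(R - 1) by ring,
      neg_div_neg_eq]] at this

/-- The substitution `z ↦ 1/z` exchanges the residue at `0` with the residue `-(A₀ + A₁)` at `∞`. -/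
theorem reducesAll_inv (hR : R ≠ 0) (hR' : R ≠ 1) (h : ReducesAll D x R ![θ 2, θ 1, θ 0]) :
    ReducesAll D x R⁻¹ θ := by
  intro A₀ A₁ hA
  have hR₁ : R - 1 ≠ 0 := sub_ne_zero.2 hR'
  have hR₂ : 1 - R ≠ 0 := sub_ne_zero.2 hR'.symm
  have := h (-(A₀ + A₁)) A₁ ⟨by rw [Matrix.trace_neg, Matrix.trace_add, hA.1, hA.2]; simp, hA.2,
    by rw [Matrix.det_neg, hA.5]; simp, hA.4, by
      rw [neg_add, neg_add_cancel_right, Matrix.det_neg, hA.3]; simp⟩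
  rwa [Reduces, show pulledMatrix D R (-(A₀ + A₁)) A₁ = pulledMatrix D R⁻¹ A₀ A₁ by
    have e₁ : D R⁻¹ / R⁻¹ = -(D R / R) := by
      rw [Derivation.leibniz_inv, smul_eq_mul]; field_simp
    have e₂ : D R⁻¹ / (R⁻¹ - 1) = D R / (R - 1) - D R / R := by
      rw [Derivation.leibniz_inv, smul_eq_mul, show R⁻¹ - 1 = (1 - R) / R by field_simp]
      field_simp
      ring
    rw [pulledMatrix, pulledMatrix, e₁, e₂]
    ext i j
    simp
    ring] at this

theorem Reduces.of_conj {A₀ A₁ B₀ B₁ U : Matrix (Fin 2) (Fin 2) ℂ} (hU : U.det ≠ 0)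
    (h₀ : U * A₀ = B₀ * U) (h₁ : U * A₁ = B₁ * U) (h : Reduces D x R B₀ B₁) :
    Reduces D x R A₀ A₁ := by
  obtain ⟨A, g, T, hA, hT⟩ := h
  refine ⟨A, _, _, hA, (isGauge_of_conj (g := algebraMap ℂ K U.det⁻¹)
    (U := U.map (algebraMap ℂ K)) (D.map_algebraMap _) ?_ ?_ ?_).trans hT⟩
  · ext i j
    simp
  · rw [← RingHom.mapMatrix_apply, ← RingHom.map_det, ← map_mul, inv_mul_cancel₀ hU, map_one]
  · have e₀ := congrArg (Matrix.map · (algebraMap ℂ K)) h₀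
    have e₁ := congrArg (Matrix.map · (algebraMap ℂ K)) h₁
    simp only [Matrix.map_mul] at e₀ e₁
    simp only [pulledMatrix, Matrix.mul_add, Matrix.add_mul, Matrix.mul_smul, Matrix.smul_mul,
      e₀, e₁]

theorem pulledMatrix_of (a b c d a' b' c' d' : ℂ) :
    pulledMatrix D R !![a, b; c, d] !![a', b'; c', d'] =
      !![D R / R * algebraMap ℂ K a + D R / (R - 1) * algebraMap ℂ K a',
        D R / R * algebraMap ℂ K b + D R / (R - 1) * algebraMap ℂ K b';
        D R / R * algebraMap ℂ K c + D R / (R - 1) * algebraMap ℂ K c',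
        D R / R * algebraMap ℂ K d + D R / (R - 1) * algebraMap ℂ K d'] := by
  ext i j
  fin_cases i <;> fin_cases j <;> rfl

theorem IsIrreducibleTriple.reducesAll (hθ : IsIrreducibleTriple θ)
    (h : Reduces D x R (normalZero θ) (normalOne θ)) : ReducesAll D x R θ := by
  intro A₀ A₁ hA
  obtain ⟨U, hU, h₀, h₁⟩ := hA.exists_conj hθ
  exact h.of_conj hU h₀ h₁

/-- The elementary Schlesinger transformation at `0` and `∞`. -/
theorem IsIrreducibleTriple.reducesAll_of_shift [CharZero K] (hθ : IsIrreducibleTriple θ)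
    (hR : R ≠ 0) (hR' : R ≠ 1) (h : ReducesAll D x R ![θ 0 + 1, θ 1, θ 2 - 1]) :
    ReducesAll D x R θ := by
  have h2 : (2 : K) ≠ 0 := two_ne_zero
  apply hθ.reducesAll
  have hR₁ : R - 1 ≠ 0 := sub_ne_zero.2 hR'
  set c : ℂ := ((θ 0 + θ 2) / 2) ^ 2 - (θ 1 / 2) ^ 2 with hc
  -- These are the residues after the gauge `diag(√R, 1/√R)`. The upper right entry `1/z - 1/(z-1)`
  -- of the normal form becomes `-1/(z-1)`, and the lower left entry `c/(z-1)` becomes `c/(z-1) -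
  -- c/z`, so no higher poles appear.
  obtain ⟨A, g, T, hA, hT⟩ := h !![θ 0 / 2 + 1 / 2, 0; -c, -(θ 0 / 2 + 1 / 2)]
    !![-((θ 0 + θ 2) / 2), -1; c, (θ 0 + θ 2) / 2] (by
      constructor <;> simp [Matrix.trace_fin_two, Matrix.det_fin_two, hc] <;> ring)
  refine ⟨A, _, _, hA, IsGauge.trans (g₁ := R⁻¹) (T₁ := !![R, 0; 0, 1]) ⟨?_, ?_⟩ hT⟩
  · simp [Matrix.det_fin_two, hR]
  · have e : D R⁻¹ / (2 * R⁻¹) = -(D R / R) / 2 := by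
      rw [Derivation.leibniz_inv, smul_eq_mul]; field_simp
    have hm : (!![R, 0; 0, 1] : Matrix (Fin 2) (Fin 2) K).map D = !![D R, 0; 0, 0] := by
      ext i j
      fin_cases i <;> fin_cases j <;> simp
    rw [e, hm, normalZero, normalOne, ← hc, pulledMatrix_of, pulledMatrix_of, Matrix.mul_fin_two,
      Matrix.mul_fin_two]
    ext i j
    fin_cases i <;> fin_cases j <;> simp [map_ofNat (algebraMap ℂ K) 2]
    · field_simp; ring
    · field_simp; ring
    · field_simp; ring
    · field_simp; ring

end Reduction

/-! ### Integer shifts of the exponent differences -/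

section Shifts

variable {K : Type*} [Field K] [Algebra ℂ K] {D : Derivation ℂ K K} {x R : K}
  {θ θ' : Fin 3 → ℂ}

theorem intUnit_mul_self (ε : ℤˣ) : ((ε : ℤ) : ℂ) * ((ε : ℤ) : ℂ) = 1 := by
  rcases Int.units_eq_one_or ε with h | h <;> rw [h] <;> simp

theorem IsIrreducibleTriple.congr (hθ : IsIrreducibleTriple θ)
    (h : ∀ i, ∃ (l : ℤ) (ε : ℤˣ), θ' i = (l : ℂ) + ((ε : ℤ) : ℂ) * θ i) :
    IsIrreducibleTriple θ' := by
  choose l ε h using h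
  intro α β n hn
  apply hθ (ε 0 * (α * ε 1)) (ε 0 * (β * ε 2))
    ((ε 0 : ℤ) * (n - l 0 - α * l 1 - β * l 2))
  rw [h 0, h 1, h 2] at hn
  push_cast
  linear_combination ((ε 0 : ℤ) : ℂ) * hn - θ 0 * intUnit_mul_self (ε 0)

theorem reducesAll_of_shift_sub_nat [CharZero K] (hR : R ≠ 0) (hR' : R ≠ 1) (n : ℕ) :
    ∀ θ : Fin 3 → ℂ, IsIrreducibleTriple θ →
      ReducesAll D x R ![θ 0 + n, θ 1, θ 2 - n] → ReducesAll D x R θ := by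
  induction n with
  | zero =>
    intro θ _ h
    exact h.congr_sq fun i => by fin_cases i <;> simp
  | succ n ih =>
    intro θ hθ h
    refine hθ.reducesAll_of_shift hR hR' (ih _ (hθ.congr fun i => ?_) (h.congr_sq fun i => ?_))
    · fin_cases i
      · exact ⟨1, 1, by simp; ring⟩
      · exact ⟨0, 1, by simp⟩
      · exact ⟨-1, 1, by simp; ring⟩
    · fin_cases i
      · simp; ring
      · simp
      · simp; ring

theorem IsIrreducibleTriple.reducesAll_of_shift_sub [CharZero K] (hθ : IsIrreducibleTriple θ)
    (hR : R ≠ 0) (hR' : R ≠ 1) (m : ℤ) (h : ReducesAll D x R ![θ 0 + m, θ 1, θ 2 - m]) :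
    ReducesAll D x R θ := by
  obtain ⟨n, rfl | rfl⟩ := m.eq_nat_or_neg
  · exact reducesAll_of_shift_sub_nat hR hR' n θ hθ (by exact_mod_cast h)
  -- A negative shift of `θ` is a positive shift of `-θ`.
  · have h' := reducesAll_of_shift_sub_nat (D := D) (x := x) hR hR' n (fun i => -θ i)
      (hθ.congr fun i => ⟨0, -1, by simp⟩) (h.congr_sq fun i => by
        fin_cases i
        · simp; ring
        · simp
        · simp; ring)
    exact h'.congr_sq fun i => by simp

theorem IsIrreducibleTriple.reducesAll_of_shift_add [CharZero K] (hθ : IsIrreducibleTriple θ)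
    (hR : R ≠ 0) (hR' : R ≠ 1) (m : ℤ) (h : ReducesAll D x R ![θ 0 + m, θ 1, θ 2 + m]) :
    ReducesAll D x R θ := by
  have hθ' : IsIrreducibleTriple ![θ 0, θ 1, -θ 2] := hθ.congr fun i => by
    fin_cases i
    · exact ⟨0, 1, by simp⟩
    · exact ⟨0, 1, by simp⟩
    · exact ⟨0, -1, by simp⟩
  refine (hθ'.reducesAll_of_shift_sub hR hR' m (h.congr_sq fun i => ?_)).congr_sq fun i => ?_
  · fin_cases i
    · simp
    · simp
    · simp; ring
  · fin_cases i <;> simp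

/-- Conjugation of the shift at `0` and `∞` by `z ↦ 1 - z`. -/
theorem IsIrreducibleTriple.reducesAll_of_shift_add' [CharZero K] (hθ : IsIrreducibleTriple θ)
    (hR : R ≠ 0) (hR' : R ≠ 1) (m : ℤ) (h : ReducesAll D x R ![θ 0, θ 1 + m, θ 2 + m]) :
    ReducesAll D x R θ := by
  have hθ' : IsIrreducibleTriple ![θ 1, θ 0, θ 2] := by
    intro ε δ n hn
    apply hθ ε (ε * δ) (ε * n)
    simp at hn
    push_cast
    linear_combination ((ε : ℤ) : ℂ) * hn - θ 0 * intUnit_mul_self ε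
  have h₁ := hθ'.reducesAll_of_shift_add (D := D) (x := x) (R := 1 - R)
    (sub_ne_zero.2 hR'.symm) (by simpa using hR) m (reducesAll_one_sub (by simpa using h))
  have h₂ := reducesAll_one_sub (θ := θ) h₁
  rwa [sub_sub_cancel] at h₂

/-- Schlesinger transformations shift the exponent differences by integers with even sum. -/
theorem IsIrreducibleTriple.reducesAll_of_even [CharZero K] (hθ : IsIrreducibleTriple θ)
    (hR : R ≠ 0) (hR' : R ≠ 1) (l : Fin 3 → ℤ) (hl : Even (∑ i, l i))
    (h : ReducesAll D x R fun i => θ i + l i) : ReducesAll D x R θ := by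
  obtain ⟨s, hs⟩ := hl
  rw [Fin.sum_univ_three] at hs
  have key : ∀ a b c : ℤ, IsIrreducibleTriple ![θ 0 + a, θ 1 + b, θ 2 + c] := by
    intro a b c
    refine hθ.congr fun i => ?_
    fin_cases i
    · exact ⟨a, 1, by simp; ring⟩
    · exact ⟨b, 1, by simp; ring⟩
    · exact ⟨c, 1, by simp; ring⟩
  have hl2 : (l 2 : ℂ) = 2 * s - l 0 - l 1 := by
    exact_mod_cast (by linarith : l 2 = 2 * s - l 0 - l 1)
  -- With `∑ l = 2s`, the vector `l` is the sum of `(l₀, 0, l₀)`, `(0, l₁, l₁)`, `(m, 0, m)` and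
  -- `(-m, 0, m)`, where `m = s - l₀ - l₁`.
  refine hθ.reducesAll_of_shift_add hR hR' (l 0) ?_
  refine IsIrreducibleTriple.reducesAll_of_shift_add' (by simpa using key (l 0) 0 (l 0)) hR hR'
    (l 1) ?_
  refine IsIrreducibleTriple.reducesAll_of_shift_add (m := s - l 0 - l 1)
    (by simpa [add_assoc] using key (l 0) (l 1) (l 0 + l 1)) hR hR' ?_
  refine IsIrreducibleTriple.reducesAll_of_shift_sub (m := -(s - l 0 - l 1)) ?_ hR hR' ?_
  · simpa [add_assoc] using key (l 0 + (s - l 0 - l 1)) (l 1) (l 0 + l 1 + (s - l 0 - l 1))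
  · refine h.congr_sq fun i => ?_
    fin_cases i
    · simp; ring
    · simp
    · simp [hl2]; ring

/-- If one of the exponent differences is `1/2`, all integer shifts can be realized. -/
theorem IsIrreducibleTriple.reducesAll_of_shifts [CharZero K] (hθ : IsIrreducibleTriple θ)
    (hR : R ≠ 0) (hR' : R ≠ 1) (j : Fin 3) (hj : θ j = 1 / 2) (h : ReducesAll D x R θ)
    (hθ' : ∀ i, ∃ (l : ℤ) (ε : ℤˣ), θ' i = (l : ℂ) + ((ε : ℤ) : ℂ) * θ i) :
    ReducesAll D x R θ' := by
  obtain ⟨l, ε, hl, he⟩ : ∃ (l : Fin 3 → ℤ) (ε : Fin 3 → ℤˣ), Even (∑ i, l i) ∧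
      ∀ i, θ' i = (l i : ℂ) + ((ε i : ℤ) : ℂ) * θ i := by
    choose l ε he using hθ'
    by_cases hl : Even (∑ i, l i)
    · exact ⟨l, ε, hl, he⟩
    -- Since `ε/2 = ε - ε/2`, reversing the sign at `j` changes the shift there by the odd number
    -- `ε`.
    · refine ⟨l + Pi.single j (ε j : ℤ), Function.update ε j (-ε j), ?_, fun i => ?_⟩
      · have hodd : Odd ((ε j : ℤˣ) : ℤ) := by
          rcases Int.units_eq_one_or (ε j) with h | h <;> rw [h] <;> decide
        simp only [Pi.add_apply, Finset.sum_add_distrib, Finset.sum_pi_single', Finset.mem_univ, if_true]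
        exact (Int.not_even_iff_odd.1 hl).add_odd hodd
      · by_cases hij : i = j
        · subst hij
          rw [he i, hj]
          simp
          ring
        · simp [he i, hij]
  have hsq := fun i => intUnit_mul_self (ε i)
  have hirr : IsIrreducibleTriple fun i => ((ε i : ℤ) : ℂ) * θ' i := hθ.congr fun i =>
    ⟨ε i * l i, 1, by rw [he i]; push_cast; linear_combination θ i * hsq i⟩
  have hev : Even (∑ i, -(ε i * l i : ℤ)) := by
    rw [Finset.sum_neg_distrib, even_neg]
    have : ∀ i, Even (ε i * l i - l i : ℤ) := fun i => by
      rcases Int.units_eq_one_or (ε i) with h | h <;> rw [h]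
      · simp
      · exact ⟨-l i, by simp; ring⟩
    have h2 := Finset.even_sum (fun i => (ε i * l i - l i : ℤ)) (s := Finset.univ)
      (fun i _ => this i)
    rw [Finset.sum_sub_distrib] at h2
    simpa using h2.add hl
  refine (hirr.reducesAll_of_even hR hR' _ hev (h.congr_sq fun i => ?_)).congr_sq fun i => ?_
  · congr 1
    rw [he i]
    push_cast
    linear_combination - θ i * hsq i
  · linear_combination θ' i ^ 2 * hsq i

end Shifts

/-! ### Reduction of systems in normal form -/

section Base

variable {K : Type*} [Field K] [CharZero K] [Algebra ℂ K] {D : Derivation ℂ K K} {x R : K}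
  {θ : Fin 3 → ℂ}

/-- Specializes `isGauge_of_solutions` to the normal form, with `ρ = r/x`. The logarithmic
derivatives `L₀`, `L₁` are parameters so that each example can supply them in factored form. -/
theorem reduces_normal_of_solutions {r a b c : ℚ} (hr : r ≠ 0)
    {L₀ L₁ u γ ρ x₁ x₂ q₁ q₂ : K} (hL₀ : D R / R = L₀) (hL₁ : D R / (R - 1) = L₁)
    (ha : θ 0 / 2 = a) (hb : (θ 0 + θ 2) / 2 = b) (hc : b ^ 2 - (θ 1 / 2) ^ 2 = c)
    (hu : u = a * L₀ - b * L₁) (hρ : ρ = r / x)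
    (hx₁ : D x₁ = (u + γ - ρ) * x₁ + (L₀ - L₁) * q₁)
    (hq₁ : D q₁ = c * L₁ * x₁ + (-u + γ - ρ) * q₁)
    (hx₂ : D x₂ = (u + γ + ρ) * x₂ + (L₀ - L₁) * q₂)
    (hq₂ : D q₂ = c * L₁ * x₂ + (-u + γ + ρ) * q₂) (hw : x₁ * q₂ - x₂ * q₁ ≠ 0) :
    Reduces D x R (normalZero θ) (normalOne θ) := by
  have hP : pulledMatrix D R (normalZero θ) (normalOne θ) = !![u, L₀ - L₁; c * L₁, -u] := by
    rw [normalZero, normalOne, pulledMatrix_of, hL₀, hL₁, hb, hc, ha, hu]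
    ext i j
    fin_cases i <;> fin_cases j <;> simp <;> ring
  have hA : x⁻¹ • (!![(r : ℂ), 0; 0, -(r : ℂ)]).map (algebraMap ℂ K) = !![ρ, 0; 0, -ρ] := by
    ext i j
    fin_cases i <;> fin_cases j <;> simp [hρ] <;> ring
  have hgauge := isGauge_of_solutions (D := D) (P := !![u, L₀ - L₁; c * L₁, -u])
    two_ne_zero (by simp) hx₁ hq₁ hx₂ hq₂ hw
  refine ⟨!![(r : ℂ), 0; 0, -(r : ℂ)], _, _, ⟨by simp [Matrix.trace_fin_two], r, hr, ?_⟩,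
    hP ▸ hA ▸ hgauge⟩
  rw [Matrix.charpoly_fin_two, pmPoly]
  simp [Matrix.trace_fin_two, Matrix.det_fin_two]
  ring

/-- The case in which the quotient of two solutions is a power of `x`. -/
theorem reduces_normal_of_power (hx : x ≠ 0) (hDx : D x = 1) {r a b c : ℚ} (hr : r ≠ 0)
    {L₀ L₁ u : K} (hL₀ : D R / R = L₀) (hL₁ : D R / (R - 1) = L₁)
    (ha : θ 0 / 2 = a) (hb : (θ 0 + θ 2) / 2 = b) (hc : b ^ 2 - (θ 1 / 2) ^ 2 = c)
    (hc₀' : c ≠ 0) (hL : L₁ ≠ 0)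
    (hu : u = a * L₀ - b * L₁ + (D L₁ / L₁ + 1 / x) / 2)
    (h : D u - u ^ 2 + u / x + (r / x) ^ 2 = c * L₁ * (L₀ - L₁)) :
    Reduces D x R (normalZero θ) (normalOne θ) := by
  obtain ⟨δ, hδ⟩ : ∃ δ, D L₁ = δ * L₁ := ⟨D L₁ / L₁, by field_simp⟩
  have hδ' : D L₁ / L₁ = δ := by rw [hδ]; field_simp
  rw [hδ'] at hu
  have hDq : ∀ q : ℚ, D (q : K) = 0 := fun q => by simpa using D.map_algebraMap (q : ℂ)
  have hc₀ : (c : K) ≠ 0 := by exact_mod_cast hc₀'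
  have hr' : (r : K) ≠ 0 := by exact_mod_cast hr
  -- With second component `1`, the second equation of the system forces the first component `(u +
  -- ρ)/(c L₁)`. The first equation then becomes the Riccati equation `h`, which involves only `ρ²`,
  -- so both signs of `ρ` solve it.
  have hsol : ∀ ρ : K, ρ ^ 2 = (r / x) ^ 2 → D ρ = - ρ / x →
      D ((u + ρ) / (c * L₁)) = (a * L₀ - b * L₁ + -(δ + 1 / x) / 2 - ρ) * ((u + ρ) / (c * L₁)) +
        (L₀ - L₁) * 1 := by
    intro ρ hρ hDρ
    rw [Derivation.leibniz_div, Derivation.leibniz, map_add, hDρ, hDq, hδ]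
    simp only [smul_eq_mul]
    have h' : D u = u ^ 2 - u / x - ρ ^ 2 + c * L₁ * (L₀ - L₁) := by
      rw [hρ]; linear_combination h
    rw [h', show a * L₀ - b * L₁ + -(δ + 1 / x) / 2 - ρ = u - δ - 1 / x - ρ by rw [hu]; ring]
    field_simp
    ring
  have hDρ : D ((r : K) / x) = -(r / x) / x := by
    rw [Derivation.leibniz_div, hDq, hDx]; simp; field_simp
  -- The determinant of the two solutions is `2r/(x c L₁)`, and `γ` is half its logarithmic
  -- derivative.
  refine reduces_normal_of_solutions hr hL₀ hL₁ ha hb hc rfl rfl (γ := -(δ + 1 / x) / 2)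
    (q₁ := 1) (q₂ := 1) (hsol _ rfl hDρ) ?_ (x₂ := (u + -(r / x)) / (c * L₁)) ?_ ?_ ?_
  · rw [D.map_one_eq_zero, hu]; field_simp; ring
  · convert! hsol (-(r / x)) (by ring) (by rw [map_neg, hDρ]; ring) using 2
    ring
  · rw [D.map_one_eq_zero, hu]; field_simp; ring
  · rw [show (u + r / x) / (c * L₁) * 1 - (u + -(r / x)) / (c * L₁) * 1 = 2 * r / (x * (c * L₁)) by
      field_simp; ring]
    exact div_ne_zero (mul_ne_zero two_ne_zero hr') (mul_ne_zero hx (mul_ne_zero hc₀ hL))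

end Base

/-! ### Explicit solutions for the dihedral and polyhedral covers -/

section Examples

variable {K : Type*} [Field K] [Algebra ℂ K] {D : Derivation ℂ K K} {x : K}

theorem derivation_ofNat (n : ℕ) [n.AtLeastTwo] : D ofNat(n) = 0 := D.map_natCast n

/-- The dihedral case. -/
theorem reduces_dihedral [CharZero K] (hDx : D x = 1) (hx : x ≠ 0) (h₁ : x + 1 ≠ 0) (h₂ : x - 1 ≠ 0)
    {r : ℚ} (hr : r ≠ 0) :
    Reduces D x (((x + 1) / (x - 1)) ^ 2) (normalZero ![-1 / 2, 2 * r, 1 / 2])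
      (normalOne ![-1 / 2, 2 * r, 1 / 2]) := by
  have hD : D (((x + 1) / (x - 1)) ^ 2) = -4 * (x + 1) / (x - 1) ^ 3 := by
    rw [Derivation.leibniz_pow, Derivation.leibniz_div]
    simp [hDx]
    field_simp
    ring
  have hL₁ : D (((x + 1) / (x - 1)) ^ 2) / (((x + 1) / (x - 1)) ^ 2 - 1) =
      -(x + 1) / (x * (x - 1)) := by
    rw [hD, show ((x + 1) / (x - 1)) ^ 2 - 1 = 4 * x / (x - 1) ^ 2 by field_simp; ring]
    field_simp
  have hDL : D (-(x + 1) / (x * (x - 1))) = (x ^ 2 + 2 * x - 1) / (x * (x - 1)) ^ 2 := by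
    simp [Derivation.leibniz_div, hDx]
    field_simp
    ring
  refine reduces_normal_of_power hx hDx hr (L₀ := -4 / ((x + 1) * (x - 1)))
    (a := -1 / 4) (b := 0) (c := - r ^ 2) (u := 0) ?_ hL₁ ?_ ?_ ?_ ?_ ?_ ?_ ?_
  · rw [hD]; field_simp
  · simp; norm_num
  · simp; norm_num
  · simp
  · simpa using hr
  · exact div_ne_zero (neg_ne_zero.2 h₁) (mul_ne_zero hx h₂)
  · rw [hDL]; field_simp; push_cast; ring
  · simp; field_simp; ring

/-- The tetrahedral case. -/
theorem reduces_tetrahedral [CharZero K] (hDx : D x = 1) (hx : x ≠ 0) (h₁ : x + 1 ≠ 0)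
    (h₂ : x - 8 ≠ 0) (h₃ : x ^ 2 + 20 * x - 8 ≠ 0) :
    Reduces D x (-(64 * (x + 1) ^ 3) / (x * (x - 8) ^ 3)) (normalZero ![-2 / 3, 1 / 2, 1 / 3])
      (normalOne ![-2 / 3, 1 / 2, 1 / 3]) := by
  obtain ⟨G, hG⟩ : ∃ G, G = x + 1 := ⟨_, rfl⟩
  obtain ⟨H, hH⟩ : ∃ H, H = x - 8 := ⟨_, rfl⟩
  obtain ⟨Q, hQ⟩ : ∃ Q, Q = x ^ 2 + 20 * x - 8 := ⟨_, rfl⟩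
  have dG : D G = 1 := by simp [hG, hDx]
  have dH : D H = 1 := by simp [hH, hDx, derivation_ofNat]
  have dQ : D Q = 2 * x + 20 := by simp [hQ, hDx, derivation_ofNat]
  rw [← hG] at h₁
  rw [← hH] at h₂
  rw [← hQ] at h₃
  rw [← hG, ← hH]
  have hD : D (-(64 * G ^ 3) / (x * H ^ 3)) = 64 * G ^ 2 * Q / (x ^ 2 * H ^ 4) := by
    simp [Derivation.leibniz_div, hDx, dG, dH, derivation_ofNat]
    field_simp
    rw [hG, hH, hQ]
    ring
  have hL₁ : D (-(64 * G ^ 3) / (x * H ^ 3)) / (-(64 * G ^ 3) / (x * H ^ 3) - 1) =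
      -64 * G ^ 2 / (x * H * Q) := by
    -- The tetrahedral identity `64 G³ + x H³ = Q²`: every point over `1` is double.
    rw [hD, show -(64 * G ^ 3) / (x * H ^ 3) - 1 = -Q ^ 2 / (x * H ^ 3) by
      field_simp; rw [hG, hH, hQ]; ring]
    field_simp
  refine reduces_normal_of_power hx hDx (r := 1 / 6) (by norm_num) (L₀ := -Q / (x * G * H))
    (a := -1 / 3) (b := -1 / 6) (c := -5 / 144)
    (u := -1 / 3 * (-Q / (x * G * H)) + 1 / 6 * (-64 * G ^ 2 / (x * H * Q)) +
      (2 / G - 1 / H - (2 * x + 20) / Q) / 2) ?_ hL₁ ?_ ?_ ?_ ?_ ?_ ?_ ?_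
  · rw [hD]; field_simp
  · simp; norm_num
  · simp; norm_num
  · simp; norm_num
  · norm_num
  · exact div_ne_zero (mul_ne_zero (by norm_num) (pow_ne_zero _ h₁))
      (mul_ne_zero (mul_ne_zero hx h₂) h₃)
  · simp [Derivation.leibniz_div, hDx, dG, dH, dQ, derivation_ofNat]
    field_simp
    ring
  · simp [Derivation.leibniz_div, Derivation.leibniz_inv, hDx, dG, dH, dQ, derivation_ofNat]
    field_simp
    rw [hG, hH, hQ]
    ring

/-- The octahedral case. -/
theorem reduces_octahedral [CharZero K] (hDx : D x = 1) (hx : x ≠ 0) (h₁ : x + 1 ≠ 0)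
    (h₂ : x ^ 2 - 14 * x + 1 ≠ 0) (h₃ : x ^ 3 + 33 * x ^ 2 - 33 * x - 1 ≠ 0) :
    Reduces D x (-(108 * (x + 1) ^ 4 * x) / (x ^ 2 - 14 * x + 1) ^ 3)
      (normalZero ![-3 / 4, 1 / 2, 1 / 3]) (normalOne ![-3 / 4, 1 / 2, 1 / 3]) := by
  obtain ⟨G, hG⟩ : ∃ G, G = x + 1 := ⟨_, rfl⟩
  obtain ⟨H, hH⟩ : ∃ H, H = x ^ 2 - 14 * x + 1 := ⟨_, rfl⟩
  obtain ⟨Q, hQ⟩ : ∃ Q, Q = x ^ 3 + 33 * x ^ 2 - 33 * x - 1 := ⟨_, rfl⟩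
  have dG : D G = 1 := by simp [hG, hDx]
  have dH : D H = 2 * x - 14 := by simp [hH, hDx, derivation_ofNat]
  have dQ : D Q = 3 * x ^ 2 + 66 * x - 33 := by simp [hQ, hDx, derivation_ofNat]; ring
  rw [← hG] at h₁
  rw [← hH] at h₂
  rw [← hQ] at h₃
  rw [← hG, ← hH]
  have hD : D (-(108 * G ^ 4 * x) / H ^ 3) = 108 * G ^ 3 * Q / H ^ 4 := by
    simp [Derivation.leibniz_div, hDx, dG, dH, derivation_ofNat]
    field_simp
    rw [hG, hH, hQ]
    ring
  have hL₁ : D (-(108 * G ^ 4 * x) / H ^ 3) / (-(108 * G ^ 4 * x) / H ^ 3 - 1) =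
      -108 * G ^ 3 / (H * Q) := by
    -- The octahedral identity `108 x G⁴ + H³ = Q²`.
    rw [hD, show -(108 * G ^ 4 * x) / H ^ 3 - 1 = -Q ^ 2 / H ^ 3 by
      field_simp; rw [hG, hH, hQ]; ring]
    field_simp
  refine reduces_normal_of_power hx hDx (r := 1 / 8) (by norm_num) (L₀ := -Q / (x * G * H))
    (a := -3 / 8) (b := -5 / 24) (c := -11 / 576)
    (u := -3 / 8 * (-Q / (x * G * H)) + 5 / 24 * (-108 * G ^ 3 / (H * Q)) +
      (3 / G - (2 * x - 14) / H - (3 * x ^ 2 + 66 * x - 33) / Q + 1 / x) / 2)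
    ?_ hL₁ ?_ ?_ ?_ ?_ ?_ ?_ ?_
  · rw [hD]; field_simp
  · simp; norm_num
  · simp; norm_num
  · simp; norm_num
  · norm_num
  · exact div_ne_zero (mul_ne_zero (by norm_num) (pow_ne_zero _ h₁)) (mul_ne_zero h₂ h₃)
  · simp [Derivation.leibniz_div, dG, dH, dQ, derivation_ofNat]
    field_simp
    ring
  · simp [Derivation.leibniz_div, Derivation.leibniz_inv, hDx, dG, dH, dQ, derivation_ofNat]
    field_simp
    rw [hG, hH, hQ]
    ring

/-! ### The icosahedral cover, for rows 6 and 14 -/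

section Icosahedral

variable {G H Q : K}

theorem derivation_icosahedral [CharZero K]
    (hG : G = x ^ 4 + 228 * x ^ 3 + 494 * x ^ 2 - 228 * x + 1) (hH : H = x ^ 2 - 11 * x - 1)
    (hQ : Q = x ^ 6 - 522 * x ^ 5 - 10005 * x ^ 4 - 10005 * x ^ 2 + 522 * x + 1)
    (hDx : D x = 1) (hx : x ≠ 0) (h₂ : H ≠ 0) :
    D (G ^ 3 / (1728 * x * H ^ 5)) = G ^ 2 * Q / (1728 * x ^ 2 * H ^ 6) := by
  have dG : D G = 4 * x ^ 3 + 684 * x ^ 2 + 988 * x - 228 := by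
    simp [hG, hDx, derivation_ofNat]; ring
  have dH : D H = 2 * x - 11 := by simp [hH, hDx, derivation_ofNat]
  simp [Derivation.leibniz_div, hDx, dG, dH, derivation_ofNat]
  field_simp
  rw [hG, hH, hQ]
  ring

/-- Rests on Klein's identity `G³ - 1728 x H⁵ = Q²` between the face, vertex and edge forms of the
icosahedron. -/
theorem logDeriv_one_icosahedral [CharZero K]
    (hG : G = x ^ 4 + 228 * x ^ 3 + 494 * x ^ 2 - 228 * x + 1) (hH : H = x ^ 2 - 11 * x - 1)
    (hQ : Q = x ^ 6 - 522 * x ^ 5 - 10005 * x ^ 4 - 10005 * x ^ 2 + 522 * x + 1)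
    (hDx : D x = 1) (hx : x ≠ 0) (h₂ : H ≠ 0)
    (h₃ : Q ≠ 0) : D (G ^ 3 / (1728 * x * H ^ 5)) / (G ^ 3 / (1728 * x * H ^ 5) - 1) =
      G ^ 2 / (x * H * Q) := by
  rw [derivation_icosahedral hG hH hQ hDx hx h₂,
    show G ^ 3 / (1728 * x * H ^ 5) - 1 = Q ^ 2 / (1728 * x * H ^ 5) by
      field_simp; rw [hG, hH, hQ]; ring]
  field_simp

/-- The icosahedral case. -/
theorem reduces_icosahedral [CharZero K]
    (hG : G = x ^ 4 + 228 * x ^ 3 + 494 * x ^ 2 - 228 * x + 1) (hH : H = x ^ 2 - 11 * x - 1)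
    (hQ : Q = x ^ 6 - 522 * x ^ 5 - 10005 * x ^ 4 - 10005 * x ^ 2 + 522 * x + 1)
    (hDx : D x = 1) (hx : x ≠ 0) (h₁ : G ≠ 0) (h₂ : H ≠ 0)
    (h₃ : Q ≠ 0) :
    Reduces D x (G ^ 3 / (1728 * x * H ^ 5)) (normalZero ![-2 / 3, 1 / 2, 1 / 5])
      (normalOne ![-2 / 3, 1 / 2, 1 / 5]) := by
  have dG : D G = 4 * x ^ 3 + 684 * x ^ 2 + 988 * x - 228 := by
    simp [hG, hDx, derivation_ofNat]; ring
  have dH : D H = 2 * x - 11 := by simp [hH, hDx, derivation_ofNat]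
  have dQ : D Q = 6 * x ^ 5 - 2610 * x ^ 4 - 40020 * x ^ 3 - 20010 * x + 522 := by
    simp [hQ, hDx, derivation_ofNat]; ring
  refine reduces_normal_of_power hx hDx (r := 1 / 10) (by norm_num) (L₀ := Q / (x * G * H))
    (a := -1 / 3) (b := -7 / 30) (c := -29 / 3600)
    (u := -1 / 3 * (Q / (x * G * H)) + 7 / 30 * (G ^ 2 / (x * H * Q)) +
      (2 * (4 * x ^ 3 + 684 * x ^ 2 + 988 * x - 228) / G - (2 * x - 11) / H -
        (6 * x ^ 5 - 2610 * x ^ 4 - 40020 * x ^ 3 - 20010 * x + 522) / Q) / 2)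
    ?_ (logDeriv_one_icosahedral hG hH hQ hDx hx h₂ h₃) ?_ ?_ ?_ ?_ ?_ ?_ ?_
  · rw [derivation_icosahedral hG hH hQ hDx hx h₂]; field_simp
  · simp; norm_num
  · simp; norm_num
  · simp; norm_num
  · norm_num
  · exact div_ne_zero (pow_ne_zero _ h₁) (mul_ne_zero (mul_ne_zero hx h₂) h₃)
  · simp [Derivation.leibniz_div, hDx, dG, dH, dQ]
    field_simp
    ring
  · simp [Derivation.leibniz_div, hDx, dG, dH, dQ, derivation_ofNat]
    field_simp
    rw [hG, hH, hQ]
    ring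

/-- The case of the great icosahedron. -/
theorem reduces_icosahedral_great [CharZero K]
    (hG : G = x ^ 4 + 228 * x ^ 3 + 494 * x ^ 2 - 228 * x + 1) (hH : H = x ^ 2 - 11 * x - 1)
    (hQ : Q = x ^ 6 - 522 * x ^ 5 - 10005 * x ^ 4 - 10005 * x ^ 2 + 522 * x + 1)
    (hDx : D x = 1) (hx : x ≠ 0) (h₁ : G ≠ 0)
    (h₂ : H ≠ 0) (h₃ : Q ≠ 0) :
    Reduces D x (G ^ 3 / (1728 * x * H ^ 5)) (normalZero ![-2 / 3, 1 / 2, 2 / 5])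
      (normalOne ![-2 / 3, 1 / 2, 2 / 5]) := by
  have dG : D G = 4 * x ^ 3 + 684 * x ^ 2 + 988 * x - 228 := by
    simp [hG, hDx, derivation_ofNat]; ring
  have dH : D H = 2 * x - 11 := by simp [hH, hDx, derivation_ofNat]
  have dQ : D Q = 6 * x ^ 5 - 2610 * x ^ 4 - 40020 * x ^ 3 - 20010 * x + 522 := by
    simp [hQ, hDx, derivation_ofNat]; ring
  -- The determinant of the two solutions below is a constant times `H² Q / G²`; this is half its
  -- logarithmic derivative.
  set γ := (6 * x ^ 5 - 2610 * x ^ 4 - 40020 * x ^ 3 - 20010 * x + 522) / (2 * Q) +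
    (2 * x - 11) / H - (4 * x ^ 3 + 684 * x ^ 2 + 988 * x - 228) / G with hγ
  set u := -1 / 3 * (Q / (x * G * H)) + 2 / 15 * (G ^ 2 / (x * H * Q)) with hu
  have hDγ : D γ = (30 * x ^ 4 - 10440 * x ^ 3 - 120060 * x ^ 2 - 20010) / (2 * Q) -
      (6 * x ^ 5 - 2610 * x ^ 4 - 40020 * x ^ 3 - 20010 * x + 522) ^ 2 / (2 * Q ^ 2) +
      2 / H - (2 * x - 11) ^ 2 / H ^ 2 - (12 * x ^ 2 + 1368 * x + 988) / G +
      (4 * x ^ 3 + 684 * x ^ 2 + 988 * x - 228) ^ 2 / G ^ 2 := by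
    rw [hγ]
    simp [Derivation.leibniz_div, hDx, dG, dH, dQ, derivation_ofNat]
    field_simp
    ring
  -- The difference `2/5` with ramification `5` gives difference `2` at the roots of `H`, so the
  -- quotient of solutions must be critical there and is not a pure power. The factors `x + 7` and
  -- `1 - 7x` achieve this: the logarithmic derivative of `x^(2/5) (x + 7)/(1 - 7x)` has numerator
  -- `-(14/5) H`. As before, the second equation of the system determines the first component from
  -- `q` and `p = D q`; the claim is the first equation.
  have key : ∀ (s q p : K), D q = p → D p = 0 → D s = 0 →
      (s = 1 / 5 ∧ q = x + 7 ∧ p = 1 ∨ s = -1 / 5 ∧ q = 1 - 7 * x ∧ p = -7) →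
      D ((p + (u - γ + s / x) * q) / (-161 / 3600 * (G ^ 2 / (x * H * Q)))) =
        (u + γ - s / x) * ((p + (u - γ + s / x) * q) / (-161 / 3600 * (G ^ 2 / (x * H * Q)))) +
          (Q / (x * G * H) - G ^ 2 / (x * H * Q)) * q := by
    intro s q p hq hp hs h
    rw [hu]
    simp only [Derivation.leibniz_div, Derivation.leibniz, map_add, map_sub, hDγ, hq, hp, hs]
    simp [hDx, dG, dH, dQ, derivation_ofNat]
    rw [hγ]
    field_simp
    rcases h with ⟨rfl, rfl, rfl⟩ | ⟨rfl, rfl, rfl⟩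
    · rw [hG, hH, hQ]
      ring
    · rw [hG, hH, hQ]
      ring
  have hL : G ^ 2 / (x * H * Q) ≠ 0 :=
    div_ne_zero (pow_ne_zero _ h₁) (mul_ne_zero (mul_ne_zero hx h₂) h₃)
  have k₁ := key (1 / 5) (x + 7) 1 (by simp [hDx, derivation_ofNat]) (by simp)
    (by simp [Derivation.leibniz_inv, derivation_ofNat]) (Or.inl ⟨rfl, rfl, rfl⟩)
  have k₂ := key (-1 / 5) (1 - 7 * x) (-7) (by simp [hDx, derivation_ofNat])
    (by simp [derivation_ofNat]) (by simp [Derivation.leibniz_div, derivation_ofNat])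
    (Or.inr ⟨rfl, rfl, rfl⟩)
  refine reduces_normal_of_solutions (r := 1 / 5) (a := -1 / 3) (b := -2 / 15)
    (c := -161 / 3600) (by norm_num) (L₀ := Q / (x * G * H)) (u := u) (γ := γ)
    (q₁ := x + 7) (q₂ := 1 - 7 * x) (ρ := 1 / 5 / x) ?_
    (logDeriv_one_icosahedral hG hH hQ hDx hx h₂ h₃) ?_ ?_ ?_ ?_ ?_ k₁ ?_
    (x₂ := (-7 + (u - γ + -1 / 5 / x) * (1 - 7 * x)) / (-161 / 3600 * (G ^ 2 / (x * H * Q))))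
    ?_ ?_ ?_
  · rw [derivation_icosahedral hG hH hQ hDx hx h₂]; field_simp
  · simp; norm_num
  · simp; norm_num
  · simp; norm_num
  · rw [hu]; push_cast; ring
  · push_cast; ring
  · push_cast
    rw [mul_div_cancel₀ _ (mul_ne_zero (by norm_num) hL)]
    simp [hDx, derivation_ofNat]
    ring
  · rw [k₂]; ring
  · push_cast
    rw [mul_div_cancel₀ _ (mul_ne_zero (by norm_num) hL)]
    simp [hDx, derivation_ofNat]
    ring
  · rw [show (1 + (u - γ + 1 / 5 / x) * (x + 7)) / (-161 / 3600 * (G ^ 2 / (x * H * Q))) *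
        (1 - 7 * x) - (-7 + (u - γ + -1 / 5 / x) * (1 - 7 * x)) /
        (-161 / 3600 * (G ^ 2 / (x * H * Q))) * (x + 7) =
        (-14 / 5 * H / x) / (-161 / 3600 * (G ^ 2 / (x * H * Q))) by
      generalize -161 / 3600 * (G ^ 2 / (x * H * Q)) = e
      rw [div_mul_eq_mul_div, div_mul_eq_mul_div, ← sub_div]
      congr 1
      field_simp
      rw [hH]
      ring]
    exact div_ne_zero (div_ne_zero (mul_ne_zero (by norm_num) h₂) hx)
      (mul_ne_zero (by norm_num) hL)

end Icosahedral

end Examples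

/-! ### The field of rational functions -/

/-- The quotient rule holds for any fraction, not only for the reduced one by which `ratDeriv` is
defined; the Leibniz rule and additivity follow. -/
theorem ratDeriv_div (P : ℂ[X]) {Q : ℂ[X]} (hQ : Q ≠ 0) :
    ratDeriv (algebraMap ℂ[X] (RatFunc ℂ) P / algebraMap ℂ[X] (RatFunc ℂ) Q) =
      algebraMap ℂ[X] (RatFunc ℂ) (derivative P * Q - P * derivative Q) /
        algebraMap ℂ[X] (RatFunc ℂ) Q ^ 2 := by
  obtain ⟨f, hf⟩ : ∃ f, f = algebraMap ℂ[X] (RatFunc ℂ) P / algebraMap ℂ[X] (RatFunc ℂ) Q :=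
    ⟨_, rfl⟩
  rw [← hf, ratDeriv]
  have hq : f.denom ≠ 0 := f.denom_ne_zero
  have hpq := f.num_div_denom.trans hf
  generalize f.num = p at *
  generalize f.denom = q at *
  have hQ' := RatFunc.algebraMap_ne_zero (K := ℂ) hQ
  have hq' := RatFunc.algebraMap_ne_zero (K := ℂ) hq
  rw [div_eq_div_iff hq' hQ', ← map_mul, ← map_mul] at hpq
  have h₁ : p * Q = P * q := RatFunc.algebraMap_injective ℂ hpq
  have h₂ := congrArg derivative h₁
  rw [derivative_mul, derivative_mul] at h₂
  rw [div_eq_div_iff (pow_ne_zero _ hq') (pow_ne_zero _ hQ'), ← map_pow, ← map_pow,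
    ← map_mul, ← map_mul]
  refine congrArg _ ?_
  linear_combination (Q * q) * h₂ - (derivative q * Q + derivative Q * q) * h₁

theorem exists_eq_div (f : RatFunc ℂ) : ∃ P Q : ℂ[X], Q ≠ 0 ∧
    f = algebraMap ℂ[X] (RatFunc ℂ) P / algebraMap ℂ[X] (RatFunc ℂ) Q :=
  ⟨f.num, f.denom, f.denom_ne_zero, f.num_div_denom.symm⟩

theorem ratDeriv_algebraMap (P : ℂ[X]) :
    ratDeriv (algebraMap ℂ[X] (RatFunc ℂ) P) = algebraMap ℂ[X] (RatFunc ℂ) (derivative P) := by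
  simpa using ratDeriv_div P one_ne_zero

theorem ratDeriv_mul (f g : RatFunc ℂ) :
    ratDeriv (f * g) = f * ratDeriv g + g * ratDeriv f := by
  obtain ⟨P₁, Q₁, h₁, rfl⟩ := exists_eq_div f
  obtain ⟨P₂, Q₂, h₂, rfl⟩ := exists_eq_div g
  have h₁' := RatFunc.algebraMap_ne_zero (K := ℂ) h₁
  have h₂' := RatFunc.algebraMap_ne_zero (K := ℂ) h₂
  rw [div_mul_div_comm, ← map_mul, ← map_mul, ratDeriv_div _ (mul_ne_zero h₁ h₂),
    ratDeriv_div _ h₁, ratDeriv_div _ h₂]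
  simp only [derivative_mul, map_sub, map_mul, map_add]
  field_simp
  ring

theorem ratDeriv_add (f g : RatFunc ℂ) : ratDeriv (f + g) = ratDeriv f + ratDeriv g := by
  obtain ⟨P₁, Q₁, h₁, rfl⟩ := exists_eq_div f
  obtain ⟨P₂, Q₂, h₂, rfl⟩ := exists_eq_div g
  have h₁' := RatFunc.algebraMap_ne_zero (K := ℂ) h₁
  have h₂' := RatFunc.algebraMap_ne_zero (K := ℂ) h₂
  rw [div_add_div _ _ h₁' h₂', ← map_mul, ← map_mul, ← map_mul, ← map_add,
    ratDeriv_div _ (mul_ne_zero h₁ h₂), ratDeriv_div _ h₁, ratDeriv_div _ h₂]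
  simp only [derivative_mul, map_sub, map_mul, map_add]
  field_simp
  ring

/-- The derivative of rational functions, as a derivation. -/
noncomputable def ratDerivation : Derivation ℂ (RatFunc ℂ) (RatFunc ℂ) :=
  Derivation.mk'
    { toFun := ratDeriv
      map_add' := ratDeriv_add
      map_smul' := fun c f => by
        rw [RatFunc.smul_eq_C_mul, ratDeriv_mul, ← RatFunc.algebraMap_C, ratDeriv_algebraMap]
        simp [RatFunc.smul_eq_C_mul] }
    fun f g => by simpa using ratDeriv_mul f g

theorem ratDerivation_apply (f : RatFunc ℂ) : ratDerivation f = ratDeriv f := rfl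

theorem ratDerivation_X : ratDerivation (RatFunc.X : RatFunc ℂ) = 1 := by
  rw [ratDerivation_apply, ← RatFunc.algebraMap_X, ratDeriv_algebraMap]
  simp

theorem Reduces.exists_isRSTransformation {R : RatFunc ℂ} {A₀ A₁ : Matrix (Fin 2) (Fin 2) ℂ}
    (h : Reduces ratDerivation RatFunc.X R A₀ A₁) (hR : ∀ c : ℂ, R ≠ (RatFunc.C c : RatFunc ℂ)) :
    ∃ (A : Matrix (Fin 2) (Fin 2) ℂ) (g : RatFunc ℂ) (T : Matrix (Fin 2) (Fin 2) (RatFunc ℂ)),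
      IsTwoPointFuchsian A ∧ IsRSTransformation R g T A₀ A₁ A := by
  obtain ⟨A, g, T, hA, hdet, hT⟩ := h
  have hP : pulledMatrix ratDerivation R A₀ A₁ = pullback R A₀ A₁ := by
    rw [pulledMatrix, pullback, constMatrix, constMatrix, smul_add, smul_smul, smul_smul,
      RatFunc.algebraMap_eq_C, div_eq_mul_inv, div_eq_mul_inv]
    rfl
  refine ⟨A, g, T, hA, hR, hdet, ?_⟩
  rw [hP, RatFunc.algebraMap_eq_C] at hT
  exact hT

/-! ### Belyi functions -/

theorem rootMultiplicity_C_mul' {a : ℂ} (ha : a ≠ 0) (p : ℂ[X]) (x : ℂ) :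
    (C a * p).rootMultiplicity x = p.rootMultiplicity x := by
  by_cases hp : p = 0
  · simp [hp]
  · rw [rootMultiplicity_mul (mul_ne_zero (by simpa using ha) hp), rootMultiplicity_C, zero_add]

theorem IsBelyi.one_sub {R : RatFunc ℂ} (h : IsBelyi R) : IsBelyi (1 - R) := by
  obtain ⟨P, Q, hPQ, hQ, rfl, hd, hc⟩ := h
  have hQ' := RatFunc.algebraMap_ne_zero (K := ℂ) hQ
  have hmax : max (Q - P).natDegree Q.natDegree = max P.natDegree Q.natDegree := by
    apply le_antisymm
    · refine max_le ((natDegree_sub_le _ _).trans (max_comm _ _).le) (le_max_right _ _)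
    · refine max_le ?_ (le_max_right _ _)
      calc P.natDegree = (Q - (Q - P)).natDegree := by rw [sub_sub_cancel]
        _ ≤ _ := (natDegree_sub_le _ _).trans (max_comm _ _).le
  refine ⟨Q - P, Q, ?_, hQ, ?_, hmax ▸ hd, fun c h₀ h₁ => ?_⟩
  · rw [sub_eq_neg_add]
    simpa using (hPQ.neg_left).add_mul_right_left 1
  · rw [map_sub]; field_simp
  · have hsub : Q - P - C c * Q = C (-1) * (P - C (1 - c) * Q) := by
      simp only [map_sub, map_neg, map_one]; ring
    obtain ⟨m, d⟩ := hc (1 - c) (sub_ne_zero.2 h₁.symm) (by simpa using h₀)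
    rw [hsub, hmax, natDegree_C_mul (by norm_num)]
    exact ⟨fun x => by rw [rootMultiplicity_C_mul' (by norm_num)]; exact m x, d⟩

theorem IsBelyi.inv {R : RatFunc ℂ} (h : IsBelyi R) : IsBelyi R⁻¹ := by
  obtain ⟨P, Q, hPQ, hQ, rfl, hd, hc⟩ := h
  have hP : P ≠ 0 := by
    rintro rfl
    have := natDegree_eq_zero_of_isUnit (isCoprime_zero_left.1 hPQ)
    simp [this] at hd
  refine ⟨Q, P, hPQ.symm, hP, inv_div _ _, max_comm P.natDegree _ ▸ hd, fun c h₀ h₁ => ?_⟩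
  have hsub : Q - C c * P = C (-c) * (P - C c⁻¹ * Q) := by
    have : C c * C c⁻¹ = (1 : ℂ[X]) := by rw [← C_mul, mul_inv_cancel₀ h₀, C_1]
    simp only [map_neg]
    linear_combination (-Q) * this
  obtain ⟨m, d⟩ := hc c⁻¹ (inv_ne_zero h₀) (by simpa using h₁)
  rw [hsub, max_comm, natDegree_C_mul (neg_ne_zero.2 h₀)]
  exact ⟨fun x => by rw [rootMultiplicity_C_mul' (neg_ne_zero.2 h₀)]; exact m x, d⟩

theorem IsBelyi.ne_C {R : RatFunc ℂ} (h : IsBelyi R) (c : ℂ) : R ≠ (RatFunc.C c : RatFunc ℂ) := by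
  obtain ⟨P, Q, hPQ, hQ, rfl, hd, -⟩ := h
  intro hc
  rw [div_eq_iff (RatFunc.algebraMap_ne_zero hQ), ← RatFunc.algebraMap_C, ← map_mul] at hc
  obtain rfl := RatFunc.algebraMap_injective ℂ hc
  have hu : IsUnit Q := by
    obtain ⟨a, b, hab⟩ := hPQ
    exact isUnit_of_dvd_one ⟨a * C c + b, by linear_combination -hab⟩
  have h0 := natDegree_eq_zero_of_isUnit hu
  have := natDegree_C_mul_le c Q
  omega

theorem IsBelyi.ne_zero {R : RatFunc ℂ} (h : IsBelyi R) : R ≠ 0 := by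
  simpa using h.ne_C 0

theorem IsBelyi.ne_one {R : RatFunc ℂ} (h : IsBelyi R) : R ≠ 1 := by
  simpa using h.ne_C 1

/-- A criterion in terms of the finite critical points. -/
theorem isBelyi_of_critical {P Q : ℂ[X]} (hcop : ∀ x, P.eval x = 0 → Q.eval x ≠ 0) (hQ : Q ≠ 0)
    (hd : 0 < max P.natDegree Q.natDegree)
    (hdeg : ∀ c : ℂ, c ≠ 0 → c ≠ 1 →
      max P.natDegree Q.natDegree ≤ (P - C c * Q).natDegree + 1)
    (hcrit : ∀ x, (derivative P * Q - P * derivative Q).eval x = 0 →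
      P.eval x = 0 ∨ Q.eval x = 0 ∨ (P - Q).eval x = 0) :
    IsBelyi (algebraMap ℂ[X] (RatFunc ℂ) P / algebraMap ℂ[X] (RatFunc ℂ) Q) := by
  refine ⟨P, Q, ?_, hQ, rfl, hd, fun c h₀ h₁ => ⟨fun x => ?_, hdeg c h₀ h₁⟩⟩
  · refine isCoprime_of_irreducible_dvd (fun h => hQ h.2) fun z hz h₁ h₂ => ?_
    obtain ⟨x, hx⟩ := IsAlgClosed.exists_root z hz.degree_pos.ne'
    exact hcop x (eval_eq_zero_of_dvd_of_eval_eq_zero h₁ hx)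
      (eval_eq_zero_of_dvd_of_eval_eq_zero h₂ hx)
  -- At a multiple root of `P - cQ` the Wronskian `P'Q - PQ'` vanishes, so `hcrit` puts the value
  -- `c` at `0`, `1` or `∞`.
  · by_contra! hm
    have hne : P - C c * Q ≠ 0 := by
      intro h
      simp [h] at hm
    obtain ⟨hr, hr'⟩ := (one_lt_rootMultiplicity_iff_isRoot hne).1 hm
    simp only [IsRoot, eval_sub, eval_mul, eval_C, derivative_sub, derivative_C_mul] at hr hr'
    have hQx : Q.eval x ≠ 0 := by
      intro h
      exact hcop x (by simpa [h] using hr) h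
    rcases hcrit x (by
      simp only [eval_sub, eval_mul]
      linear_combination Q.eval x * hr' - (derivative Q).eval x * hr) with h | h | h
    · rw [h] at hr
      simp [h₀, hQx] at hr
    · exact hQx h
    · rw [eval_sub] at h
      have : (1 - c) * Q.eval x = 0 := by linear_combination hr - h
      simp [hQx, sub_eq_zero, h₁.symm] at this

theorem algebraMap_ofNat (n : ℕ) [n.AtLeastTwo] :
    algebraMap ℂ[X] (RatFunc ℂ) ofNat(n) = ofNat(n) :=
  map_ofNat _ n

theorem ratFunc_ne_zero (p : ℂ[X]) {f : RatFunc ℂ} (hf : algebraMap ℂ[X] (RatFunc ℂ) p = f)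
    (h : p.eval 0 ≠ 0) : f ≠ 0 :=
  hf ▸ RatFunc.algebraMap_ne_zero fun hp => h (by simp [hp])

theorem natDegree_sub_C_mul_of_lt {P Q : ℂ[X]} (h : P.natDegree < Q.natDegree) {c : ℂ}
    (hc : c ≠ 0) : (P - C c * Q).natDegree = Q.natDegree := by
  rw [natDegree_sub_eq_right_of_natDegree_lt, natDegree_C_mul hc]
  rwa [natDegree_C_mul hc]

theorem isBelyi_dihedral : IsBelyi (((RatFunc.X + 1) / (RatFunc.X - 1)) ^ 2) := by
  have h := isBelyi_of_critical (P := (X + 1) ^ 2) (Q := (X - 1) ^ 2) (fun x h => ?_)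
    (by simpa using X_sub_C_ne_zero (1 : ℂ)) ?_ (fun c h₀ h₁ => ?_) (fun x h => ?_)
  · simpa [div_pow] using h
  · have hx : x + 1 = 0 := by simpa using h
    have : x - 1 ≠ 0 := by
      rw [show x - 1 = -2 by linear_combination hx]; norm_num
    simpa using this
  · have : ((X + 1) ^ 2 : ℂ[X]).natDegree = 2 := by compute_degree!
    simp [this]
  · have h1 : ((X + 1) ^ 2 : ℂ[X]).natDegree = 2 := by compute_degree!
    have h2 : ((X - 1) ^ 2 : ℂ[X]).natDegree = 2 := by compute_degree!
    have h3 : ((X + 1) ^ 2 - C c * (X - 1) ^ 2 : ℂ[X]) =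
        C (1 - c) * X ^ 2 + C (2 + 2 * c) * X + C (1 - c) := by
      simp only [map_sub, map_add, map_mul, map_one, map_ofNat]; ring
    have h4 : (C (1 - c) * X ^ 2 + C (2 + 2 * c) * X + C (1 - c)).natDegree = 2 :=
      natDegree_quadratic (sub_ne_zero.2 h₁.symm)
    rw [h1, h2, h3, h4]
    norm_num
  · have : (x + 1) * (x - 1) = 0 := by
      simp [derivative_pow] at h
      linear_combination (-1 / 4) * h
    rcases mul_eq_zero.1 this with h | h
    · left; simp [h]
    · right; left; simp [h]

theorem isBelyi_tetrahedral : IsBelyi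
    (-(64 * (RatFunc.X + 1) ^ 3) / (RatFunc.X * (RatFunc.X - 8) ^ 3)) := by
  have d₁ : (-(64 * (X + 1) ^ 3) : ℂ[X]).natDegree = 3 := by
    rw [show (-(64 * (X + 1) ^ 3) : ℂ[X]) = -64 * X ^ 3 - 192 * X ^ 2 - 192 * X - 64 by ring]
    compute_degree!
  have d₂ : (X * (X - 8) ^ 3 : ℂ[X]).natDegree = 4 := by compute_degree!
  have h := isBelyi_of_critical (P := -(64 * (X + 1) ^ 3)) (Q := X * (X - 8) ^ 3) (fun x h => ?_)
    (by intro h; simp [h] at d₂) (by simp [d₁, d₂]) (fun c h₀ h₁ => ?_) (fun x h => ?_)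
  · simpa [algebraMap_ofNat] using h
  · have hx : x = -1 := by
      have : x + 1 = 0 := by simpa using h
      linear_combination this
    simp [hx]
    norm_num
  · rw [natDegree_sub_C_mul_of_lt (by rw [d₁, d₂]; norm_num) h₀, d₁, d₂]
    norm_num
  · have : (x + 1) ^ 2 * ((x - 8) ^ 2 * (x ^ 2 + 20 * x - 8)) = 0 := by
      simp [derivative_pow] at h
      linear_combination (1 / 64) * h
    rcases mul_eq_zero.1 this with h | h
    · left; simp at h; simp [h]
    rcases mul_eq_zero.1 h with h | h
    · right; left; simp at h; simp [h]
    · right; right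
      simp
      linear_combination (-(x ^ 2 + 20 * x - 8)) * h

theorem isBelyi_octahedral : IsBelyi
    (-(108 * (RatFunc.X + 1) ^ 4 * RatFunc.X) / (RatFunc.X ^ 2 - 14 * RatFunc.X + 1) ^ 3) := by
  have d₁ : (-(108 * (X + 1) ^ 4 * X) : ℂ[X]).natDegree = 5 := by
    rw [show (-(108 * (X + 1) ^ 4 * X) : ℂ[X]) =
      -108 * X ^ 5 - 432 * X ^ 4 - 648 * X ^ 3 - 432 * X ^ 2 - 108 * X by ring]
    compute_degree!
  have d₂ : ((X ^ 2 - 14 * X + 1) ^ 3 : ℂ[X]).natDegree = 6 := by compute_degree!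
  have h := isBelyi_of_critical (P := -(108 * (X + 1) ^ 4 * X)) (Q := (X ^ 2 - 14 * X + 1) ^ 3)
    (fun x h => ?_) (by intro h; simp [h] at d₂) (by simp [d₁, d₂]) (fun c h₀ h₁ => ?_)
    (fun x h => ?_)
  · simpa [algebraMap_ofNat] using h
  · have hx : x + 1 = 0 ∨ x = 0 := by simpa using h
    rcases hx with hx | hx
    · simp [show x = -1 by linear_combination hx]
      norm_num
    · simp [hx]
  · rw [natDegree_sub_C_mul_of_lt (by rw [d₁, d₂]; norm_num) h₀, d₁, d₂]
    norm_num
  · have : (x + 1) ^ 3 * ((x ^ 2 - 14 * x + 1) ^ 2 *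
        (x ^ 3 + 33 * x ^ 2 - 33 * x - 1)) = 0 := by
      simp [derivative_pow] at h
      linear_combination (1 / 108) * h
    rcases mul_eq_zero.1 this with h | h
    · left; simp at h; simp [h]
    rcases mul_eq_zero.1 h with h | h
    · right; left; simp at h; simp [h]
    · right; right
      simp
      linear_combination (-(x ^ 3 + 33 * x ^ 2 - 33 * x - 1)) * h

theorem isBelyi_icosahedral : IsBelyi
    ((RatFunc.X ^ 4 + 228 * RatFunc.X ^ 3 + 494 * RatFunc.X ^ 2 - 228 * RatFunc.X + 1) ^ 3 /
      (1728 * RatFunc.X * (RatFunc.X ^ 2 - 11 * RatFunc.X - 1) ^ 5)) := by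
  have d₁ : ((X ^ 4 + 228 * X ^ 3 + 494 * X ^ 2 - 228 * X + 1) ^ 3 : ℂ[X]).natDegree = 12 := by
    compute_degree!
  have d₂ : (1728 * X * (X ^ 2 - 11 * X - 1) ^ 5 : ℂ[X]).natDegree = 11 := by compute_degree!
  have h := isBelyi_of_critical
    (P := (X ^ 4 + 228 * X ^ 3 + 494 * X ^ 2 - 228 * X + 1) ^ 3)
    (Q := 1728 * X * (X ^ 2 - 11 * X - 1) ^ 5)
    (fun x h h' => ?_) (by intro h; simp [h] at d₂) (by simp [d₁, d₂]) (fun c h₀ h₁ => ?_)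
    (fun x h => ?_)
  · simpa [algebraMap_ofNat] using h
  · have hG : x ^ 4 + 228 * x ^ 3 + 494 * x ^ 2 - 228 * x + 1 = 0 := by simpa using h
    have hx : x ≠ 0 := by
      rintro rfl
      simp at hG
    have hH : x ^ 2 - 11 * x - 1 = 0 := by simpa [hx] using h'
    -- The combination `G - (x² + 239x - 1) H` equals `3125 x²`, so a common root would be `0`.
    apply pow_ne_zero 2 hx
    linear_combination (1 / 3125) * hG - (1 / 3125) * (x ^ 2 + 239 * x - 1) * hH
  · rw [natDegree_sub_eq_left_of_natDegree_lt (by rw [natDegree_C_mul h₀, d₁, d₂]; norm_num),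
      d₁, d₂]
    norm_num
  · have : (x ^ 4 + 228 * x ^ 3 + 494 * x ^ 2 - 228 * x + 1) ^ 2 * ((x ^ 2 - 11 * x - 1) ^ 4 *
        (x ^ 6 - 522 * x ^ 5 - 10005 * x ^ 4 - 10005 * x ^ 2 + 522 * x + 1)) = 0 := by
      simp [derivative_pow] at h
      linear_combination (1 / 1728) * h
    rcases mul_eq_zero.1 this with h | h
    · left; simp at h; simp [h]
    rcases mul_eq_zero.1 h with h | h
    · right; left; simp at h; simp [h]
    · right; right
      simp
      linear_combination
        (x ^ 6 - 522 * x ^ 5 - 10005 * x ^ 4 - 10005 * x ^ 2 + 522 * x + 1) * h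

theorem SchwarzHalfRow.isBelyi_belyi (row : SchwarzHalfRow) : IsBelyi row.belyi := by
  cases row
  · exact isBelyi_dihedral
  · exact isBelyi_tetrahedral
  · exact isBelyi_octahedral
  · exact isBelyi_icosahedral
  · exact isBelyi_icosahedral

theorem reduces_belyi_row2 : Reduces ratDerivation RatFunc.X SchwarzHalfRow.row2.belyi
    (normalZero ![-2 / 3, 1 / 2, 1 / 3]) (normalOne ![-2 / 3, 1 / 2, 1 / 3]) :=
  reduces_tetrahedral ratDerivation_X RatFunc.X_ne_zero
    (ratFunc_ne_zero (X + 1) (by simp) (by simp))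
    (ratFunc_ne_zero (X - 8) (by simp [algebraMap_ofNat]) (by simp))
    (ratFunc_ne_zero (X ^ 2 + 20 * X - 8) (by simp [algebraMap_ofNat]) (by simp))

theorem reduces_belyi_row4 : Reduces ratDerivation RatFunc.X SchwarzHalfRow.row4.belyi
    (normalZero ![-3 / 4, 1 / 2, 1 / 3]) (normalOne ![-3 / 4, 1 / 2, 1 / 3]) :=
  reduces_octahedral ratDerivation_X RatFunc.X_ne_zero
    (ratFunc_ne_zero (X + 1) (by simp) (by simp))
    (ratFunc_ne_zero (X ^ 2 - 14 * X + 1) (by simp [algebraMap_ofNat]) (by simp))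
    (ratFunc_ne_zero (X ^ 3 + 33 * X ^ 2 - 33 * X - 1) (by simp [algebraMap_ofNat]) (by simp))

theorem reduces_belyi_row6 : Reduces ratDerivation RatFunc.X SchwarzHalfRow.row6.belyi
    (normalZero ![-2 / 3, 1 / 2, 1 / 5]) (normalOne ![-2 / 3, 1 / 2, 1 / 5]) :=
  reduces_icosahedral rfl rfl rfl ratDerivation_X RatFunc.X_ne_zero
    (ratFunc_ne_zero (X ^ 4 + 228 * X ^ 3 + 494 * X ^ 2 - 228 * X + 1) (by simp [algebraMap_ofNat]) (by simp))
    (ratFunc_ne_zero (X ^ 2 - 11 * X - 1) (by simp [algebraMap_ofNat]) (by simp))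
    (ratFunc_ne_zero (X ^ 6 - 522 * X ^ 5 - 10005 * X ^ 4 - 10005 * X ^ 2 + 522 * X + 1) (by simp [algebraMap_ofNat]) (by simp))

theorem reduces_belyi_row14 : Reduces ratDerivation RatFunc.X SchwarzHalfRow.row14.belyi
    (normalZero ![-2 / 3, 1 / 2, 2 / 5]) (normalOne ![-2 / 3, 1 / 2, 2 / 5]) :=
  reduces_icosahedral_great rfl rfl rfl ratDerivation_X RatFunc.X_ne_zero
    (ratFunc_ne_zero (X ^ 4 + 228 * X ^ 3 + 494 * X ^ 2 - 228 * X + 1) (by simp [algebraMap_ofNat]) (by simp))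
    (ratFunc_ne_zero (X ^ 2 - 11 * X - 1) (by simp [algebraMap_ofNat]) (by simp))
    (ratFunc_ne_zero (X ^ 6 - 522 * X ^ 5 - 10005 * X ^ 4 - 10005 * X ^ 2 + 522 * X + 1) (by simp [algebraMap_ofNat]) (by simp))

theorem reduces_belyi_row1 (p n : ℕ) (hp : 0 < p) (hpn : 2 * p ≤ n) {r : ℚ} (hr : r ≠ 0) :
    Reduces ratDerivation RatFunc.X (SchwarzHalfRow.row1 p n hp hpn).belyi
      (normalZero ![-1 / 2, 2 * r, 1 / 2]) (normalOne ![-1 / 2, 2 * r, 1 / 2]) :=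
  reduces_dihedral ratDerivation_X RatFunc.X_ne_zero
    (ratFunc_ne_zero (X + 1) (by simp) (by simp))
    (ratFunc_ne_zero (X - 1) (by simp) (by simp)) hr

/-! ### Assembling the rows -/

theorem anharmonic_cases (τ : Equiv.Perm (Fin 3)) :
    (τ 0 = 0 ∧ τ 1 = 1 ∧ τ 2 = 2) ∨ (τ 0 = 1 ∧ τ 1 = 0 ∧ τ 2 = 2) ∨
    (τ 0 = 2 ∧ τ 1 = 1 ∧ τ 2 = 0) ∨ (τ 0 = 0 ∧ τ 1 = 2 ∧ τ 2 = 1) ∨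
    (τ 0 = 1 ∧ τ 1 = 2 ∧ τ 2 = 0) ∨ (τ 0 = 2 ∧ τ 1 = 0 ∧ τ 2 = 1) := by
  revert τ
  decide

theorem isBelyi_anharmonic {f : RatFunc ℂ} (hf : IsBelyi f) (τ : Equiv.Perm (Fin 3)) :
    IsBelyi (anharmonic τ f) := by
  have h0 := hf.ne_zero
  have h1 : f - 1 ≠ 0 := sub_ne_zero.2 hf.ne_one
  rcases anharmonic_cases τ with h | h | h | h | h | h <;> rw [anharmonic, h.1, h.2.1]
  · exact hf
  · exact hf.one_sub
  · simpa using hf.inv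
  · have e : f / (f - 1) = (1 - f⁻¹)⁻¹ := by field_simp
    exact e ▸ hf.inv.one_sub.inv
  · simpa using hf.one_sub.inv
  · have e : (f - 1) / f = 1 - f⁻¹ := by field_simp
    exact e ▸ hf.inv.one_sub

/-- Since `σ` sends `i` to `τ i`, the system in `σ ∘ f` has at the point `i` of the `f`-sphere the
exponent difference `θ (τ i)`. The six cases are compositions of `z ↦ 1 - z` and `z ↦ 1/z`. -/
theorem reducesAll_anharmonic {D : Derivation ℂ (RatFunc ℂ) (RatFunc ℂ)} {x f : RatFunc ℂ}
    (hf : IsBelyi f) (τ : Equiv.Perm (Fin 3)) {θ : Fin 3 → ℂ}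
    (h : ReducesAll D x f fun i => θ (τ i)) : ReducesAll D x (anharmonic τ f) θ := by
  have h0 := hf.ne_zero
  have h1 := hf.ne_one
  have h2 := hf.one_sub.ne_zero
  have h3 := hf.inv.one_sub.ne_zero
  have h1' : f - 1 ≠ 0 := sub_ne_zero.2 h1
  rw [show (fun i => θ (τ i)) = ![θ (τ 0), θ (τ 1), θ (τ 2)] by
    ext i; fin_cases i <;> rfl] at h
  rcases anharmonic_cases τ with ⟨e₀, e₁, e₂⟩ | ⟨e₀, e₁, e₂⟩ | ⟨e₀, e₁, e₂⟩ | ⟨e₀, e₁, e₂⟩ |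
    ⟨e₀, e₁, e₂⟩ | ⟨e₀, e₁, e₂⟩ <;> rw [e₀, e₁, e₂] at h <;> rw [anharmonic, e₀, e₁]
  · exact h.congr_sq fun i => by fin_cases i <;> rfl
  · exact reducesAll_one_sub h
  · simpa using reducesAll_inv h0 h1 h
  · have := reducesAll_inv (θ := θ) h3 hf.inv.one_sub.ne_one
      (reducesAll_one_sub (reducesAll_inv h0 h1 h))
    have e : f / (f - 1) = (1 - f⁻¹)⁻¹ := by field_simp
    exact e ▸ this
  · have := reducesAll_inv (θ := θ) h2 hf.one_sub.ne_one (reducesAll_one_sub h)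
    simpa using this
  · have := reducesAll_one_sub (θ := θ) (reducesAll_inv h0 h1 h)
    have e : (f - 1) / f = 1 - f⁻¹ := by field_simp
    exact e ▸ this

theorem isIrreducibleTriple_of_not_dvd {N a b c : ℤ} {θ : Fin 3 → ℂ} (ha : N * θ 0 = a)
    (hb : N * θ 1 = b) (hc : N * θ 2 = c) (h : ∀ α δ : ℤˣ, ¬ N ∣ a + α * b + δ * c) :
    IsIrreducibleTriple θ := by
  intro α δ m hm
  refine h α δ ⟨m, ?_⟩
  have : ((a + α * b + δ * c : ℤ) : ℂ) = ((N * m : ℤ) : ℂ) := by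
    push_cast
    rw [← hm, ← ha, ← hb, ← hc]
    ring
  exact_mod_cast this

/-- The explicit triples have first entry `s₀ - 1`: in the normal form the second component of a
solution satisfies a scalar equation with exponent differences `θ₀ + 1`, `θ₁`, `θ₂`, and these are
to be the numbers adapted to the Belyi function. The integer shift undoes the `-1`. -/
theorem SchwarzHalfRow.reducesAll (row : SchwarzHalfRow) {φ : Fin 3 → ℂ}
    (h : ∀ i, ∃ (l : ℤ) (ε : ℤˣ), φ i = (l : ℂ) + ((ε : ℤ) : ℂ) * row.symbol i) :
    ReducesAll ratDerivation RatFunc.X row.belyi φ := by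
  have hB := row.isBelyi_belyi
  have shift : ∀ {b : ℂ} {i : Fin 3}, row.symbol i = b + 1 →
      ∃ (l : ℤ) (ε : ℤˣ), φ i = (l : ℂ) + ((ε : ℤ) : ℂ) * b := by
    intro b i hs
    obtain ⟨l, ε, e⟩ := h i
    exact ⟨l + ε, ε, by rw [e, hs]; push_cast; ring⟩
  have same : ∀ {b : ℂ} {i : Fin 3}, row.symbol i = b →
      ∃ (l : ℤ) (ε : ℤˣ), φ i = (l : ℂ) + ((ε : ℤ) : ℂ) * b := by
    intro b i hs
    obtain ⟨l, ε, e⟩ := h i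
    exact ⟨l, ε, by rw [e, hs]⟩
  cases row with
  | row1 p n hp hpn =>
    obtain ⟨l, ε, e⟩ := h 1
    have hn : (n : ℂ) ≠ 0 := by exact_mod_cast (by omega : n ≠ 0)
    -- Here `0 < p/n ≤ 1/2`, so no shift of `± p/n` is an integer. This gives both irreducibility
    -- and `r ≠ 0`.
    have hint : ∀ m : ℤ, φ 1 ≠ m := by
      intro m hm
      have h1 : (ε : ℤ) * (p : ℤ) = (m - l) * n := by
        have : (((ε : ℤ) * (p : ℤ) : ℤ) : ℂ) = (((m - l) * n : ℤ) : ℂ) := by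
          push_cast
          have e' : φ 1 = l + ((ε : ℤ) : ℂ) * (p / n) := e
          rw [hm] at e'
          field_simp at e'
          linear_combination -e'
        exact_mod_cast this
      have h2 : (n : ℤ) ∣ p := by
        rcases Int.units_eq_one_or ε with h | h <;> rw [h] at h1
        · exact ⟨m - l, by simpa [mul_comm] using h1⟩
        · exact ⟨-(m - l), by simp at h1; linear_combination -h1⟩
      have := Int.le_of_dvd (by exact_mod_cast hp) h2
      omega
    obtain ⟨r, hr⟩ : ∃ r : ℚ, φ 1 = 2 * r := ⟨(l + (ε : ℤ) * (p / n)) / 2, by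
      rw [e]; push_cast; simp [SchwarzHalfRow.symbol]; ring⟩
    have hr0 : r ≠ 0 := by
      rintro rfl
      exact hint 0 (by simpa using hr)
    -- The dihedral computation allows any `r ≠ 0`, so the middle entry is `φ 1` itself and needs no
    -- shift.
    have hirr : IsIrreducibleTriple ![-1 / 2, 2 * (r : ℂ), 1 / 2] := by
      intro α δ m hm
      simp only [← hr] at hm
      have hα := intUnit_mul_self α
      rcases Int.units_eq_one_or δ with h | h <;> rw [h] at hm
      · apply hint (α * m)
        simp at hm
        push_cast
        linear_combination ((α : ℤ) : ℂ) * hm - φ 1 * hα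
      · apply hint (α * (m + 1))
        simp at hm
        push_cast
        linear_combination ((α : ℤ) : ℂ) * hm - φ 1 * hα
    refine hirr.reducesAll_of_shifts hB.ne_zero hB.ne_one 2 rfl
      (hirr.reducesAll (reduces_belyi_row1 p n hp hpn hr0)) fun i => ?_
    fin_cases i
    · exact shift (by simp [SchwarzHalfRow.symbol]; norm_num)
    · exact ⟨0, 1, by simp [hr]⟩
    · exact same rfl
  | row2 =>
    have hirr : IsIrreducibleTriple ![-2 / 3, 1 / 2, 1 / 3] :=
      isIrreducibleTriple_of_not_dvd (N := 6) (a := -4) (b := 3) (c := 2)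
        (by simp; norm_num) (by simp; norm_num) (by simp; norm_num) (by decide)
    refine hirr.reducesAll_of_shifts hB.ne_zero hB.ne_one 1 rfl
      (hirr.reducesAll reduces_belyi_row2) fun i => ?_
    fin_cases i
    · exact shift (by simp [SchwarzHalfRow.symbol]; norm_num)
    · exact same rfl
    · exact same rfl
  | row4 =>
    have hirr : IsIrreducibleTriple ![-3 / 4, 1 / 2, 1 / 3] :=
      isIrreducibleTriple_of_not_dvd (N := 12) (a := -9) (b := 6) (c := 4)
        (by simp; norm_num) (by simp; norm_num) (by simp; norm_num) (by decide)
    refine hirr.reducesAll_of_shifts hB.ne_zero hB.ne_one 1 rfl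
      (hirr.reducesAll reduces_belyi_row4) fun i => ?_
    fin_cases i
    · exact shift (by simp [SchwarzHalfRow.symbol]; norm_num)
    · exact same rfl
    · exact same rfl
  | row6 =>
    have hirr : IsIrreducibleTriple ![-2 / 3, 1 / 2, 1 / 5] :=
      isIrreducibleTriple_of_not_dvd (N := 30) (a := -20) (b := 15) (c := 6)
        (by simp; norm_num) (by simp; norm_num) (by simp; norm_num) (by decide)
    refine hirr.reducesAll_of_shifts hB.ne_zero hB.ne_one 1 rfl
      (hirr.reducesAll reduces_belyi_row6) fun i => ?_
    fin_cases i
    · exact shift (by simp [SchwarzHalfRow.symbol]; norm_num)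
    · exact same rfl
    · exact same rfl
  | row14 =>
    have hirr : IsIrreducibleTriple ![-2 / 3, 1 / 2, 2 / 5] :=
      isIrreducibleTriple_of_not_dvd (N := 30) (a := -20) (b := 15) (c := 12)
        (by simp; norm_num) (by simp; norm_num) (by simp; norm_num) (by decide)
    refine hirr.reducesAll_of_shifts hB.ne_zero hB.ne_one 1 rfl
      (hirr.reducesAll reduces_belyi_row14) fun i => ?_
    fin_cases i
    · exact shift (by simp [SchwarzHalfRow.symbol]; norm_num)
    · exact same rfl
    · exact same rfl

theorem IsHypergeometric.isResiduePair {A₀ A₁ : Matrix (Fin 2) (Fin 2) ℂ} {θ₀ θ₁ θinf : ℂ}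
    (h : IsHypergeometric A₀ A₁ θ₀ θ₁ θinf) : IsResiduePair ![θ₀, θ₁, θinf] A₀ A₁ := by
  have hdet : ∀ {A : Matrix (Fin 2) (Fin 2) ℂ} {t : ℂ}, A.charpoly = pmPoly t →
      A.det = -t ^ 2 := by
    intro A t hA
    rw [Matrix.det_eq_sign_charpoly_coeff, hA, pmPoly, coeff_zero_eq_eval_zero]
    simp
    ring
  refine ⟨h.trace_zero, h.trace_one, hdet h.charpoly_zero, hdet h.charpoly_one, ?_⟩
  rw [h.sum_eq]
  simp [Matrix.det_fin_two]
  ring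

theorem SchwarzHalfRow.exists_perm (row : SchwarzHalfRow) :
    ∃ π : Equiv.Perm (Fin 3), ∀ i, row.symbol i = row.triple (π i) := by
  have e₁ : ∀ i : Fin 3, Equiv.swap 1 2 i = ![0, 2, 1] i := by decide
  have e₂ : ∀ i : Fin 3, Equiv.swap 0 1 i = ![1, 0, 2] i := by decide
  have e₃ : ∀ i : Fin 3, (finRotate 3)⁻¹ i = ![2, 0, 1] i := by decide
  cases row
  · refine ⟨Equiv.swap 1 2, fun i => ?_⟩
    rw [e₁]
    fin_cases i <;> rfl
  · refine ⟨Equiv.swap 0 1, fun i => ?_⟩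
    rw [e₂]
    fin_cases i <;> rfl
  · refine ⟨(finRotate 3)⁻¹, fun i => ?_⟩
    rw [e₃]
    fin_cases i <;> rfl
  · refine ⟨Equiv.swap 0 1, fun i => ?_⟩
    rw [e₂]
    fin_cases i <;> rfl
  · refine ⟨(finRotate 3)⁻¹, fun i => ?_⟩
    rw [e₃]
    fin_cases i <;> rfl

theorem SchwarzHalfRow.exists_matches (row : SchwarzHalfRow) {θ₀ θ₁ θinf : ℂ}
    (h : SchwarzEquiv ![θinf - 1, θ₀, θ₁] row.triple) :
    ∃ τ : Equiv.Perm (Fin 3), Matches τ ![θ₀, θ₁, θinf] row.symbol := by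
  obtain ⟨τ, l, ε, -, h⟩ := h
  obtain ⟨π, hπ⟩ := row.exists_perm
  -- The inverse rotation passes from the order `(θ∞ - 1, θ₀, θ₁)` to `(θ₀, θ₁, θ∞)`; the `-1` is
  -- absorbed into the integer, as parity no longer matters.
  have key : ∀ j, ∃ (m : ℤ) (δ : ℤˣ),
      ![θ₀, θ₁, θinf] ((finRotate 3)⁻¹ j) = (m : ℂ) + ((δ : ℤ) : ℂ) * row.triple (τ j) := by
    have e : ∀ i : Fin 3, (finRotate 3)⁻¹ i = ![2, 0, 1] i := by decide
    intro j
    have hj := h j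
    have hsq := intUnit_mul_self (ε j)
    rw [hj, e]
    fin_cases j
    · refine ⟨1 - ε 0 * l 0, ε 0, ?_⟩
      simp at hsq ⊢
      linear_combination (1 - θinf) * hsq
    · refine ⟨-ε 1 * l 1, ε 1, ?_⟩
      simp at hsq ⊢
      linear_combination -θ₀ * hsq
    · refine ⟨-ε 2 * l 2, ε 2, ?_⟩
      simp at hsq ⊢
      linear_combination -θ₁ * hsq
  refine ⟨(finRotate 3)⁻¹ * τ⁻¹ * π, fun i => ?_⟩
  obtain ⟨m, δ, e⟩ := key (τ⁻¹ (π i))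
  exact ⟨m, δ, by simpa [hπ] using e⟩

end RSTransformation

open RSTransformation in
theorem proposition2 (row : SchwarzHalfRow) (A₀ A₁ : Matrix (Fin 2) (Fin 2) ℂ) (θ₀ θ₁ θinf : ℂ)
    (hsys : IsHypergeometric A₀ A₁ θ₀ θ₁ θinf)
    (hrow : SchwarzEquiv ![θinf - 1, θ₀, θ₁] row.triple) :
    (∃ τ : Equiv.Perm (Fin 3), Matches τ ![θ₀, θ₁, θinf] row.symbol) ∧
    ∀ τ : Equiv.Perm (Fin 3), Matches τ ![θ₀, θ₁, θinf] row.symbol →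
      IsBelyi (anharmonic τ row.belyi) ∧
      ∃ (A : Matrix (Fin 2) (Fin 2) ℂ) (g : RatFunc ℂ) (T : Matrix (Fin 2) (Fin 2) (RatFunc ℂ)),
        IsTwoPointFuchsian A ∧
        IsRSTransformation (anharmonic τ row.belyi) g T A₀ A₁ A := by
  refine ⟨row.exists_matches hrow, fun τ hτ => ?_⟩
  have hB := isBelyi_anharmonic row.isBelyi_belyi τ
  refine ⟨hB, Reduces.exists_isRSTransformation ?_ hB.ne_C⟩
  exact reducesAll_anharmonic row.isBelyi_belyi τ (row.reducesAll hτ) _ _ hsys.isResiduePair
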